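/- Let $n\ge 2$ and let $\mathfrak g_n=\mathfrak n_-\oplus\mathfrak h\oplus\mathfrak n_+$ be the simple complex Lie algebra of type $B_n$, with positive roots $e_i$ $(1\le i\le n)$ and $e_i\pm e_j$ $(1\le i<j\le n)$. Let $\tilde{\mathfrak g}_n=(\mathfrak g_n\otimes\mathbb C[t,t^{-1}])\oplus\mathbb Cc\oplus\mathbb Cd$ be the corresponding untwisted affine Lie algebra, where $c$ is central, $[d,x\otimes t^m]=m\,x\otimes t^m$, and $[x\otimes t^m,y\otimes t^k]=[x,y]\otimes t^{m+k}+m\,\delta_{m+k,0}(x|y)\,c$ with $(\cdot|\cdot)$ the Killing form of $\mathfrak g_n$. Put $\tilde{\mathfrak h}=(\mathfrak h\otimes 1)\oplus\mathbb Cc\oplus\mathbb Cd$, $\tilde{\mathfrak n}_+=(\mathfrak n_+\otimes 1)\oplus(\mathfrak g_n\otimes t\,\mathbb C[t])$ and $\tilde{\mathfrak b}_n=\tilde{\mathfrak h}\oplus\tilde{\mathfrak n}_+$ (the Borel subalgebra). For $\alpha\in\tilde{\mathfrak h}^*$ let $\tilde{\mathfrak g}_\alpha=\{x\in\tilde{\mathfrak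 g}_n : [h,x]=\alpha(h)x \text{ for all } h\in\tilde{\mathfrak h}\}$; a positive root is a nonzero $\alpha$ with $0\ne\tilde{\mathfrak g}_\alpha\subseteq\tilde{\mathfrak n}_+$. Let $\delta\in\tilde{\mathfrak h}^*$ be given by $\delta(d)=1$, $\delta(c)=0$, $\delta|_{\mathfrak h\otimes 1}=0$, regard the roots of $\mathfrak g_n$ as elements of $\tilde{\mathfrak h}^*$ vanishing on $c$ and $d$, and let $D$ be the set consisting of $\delta$, of the positive roots $\gamma$ of $\mathfrak g_n$, and of the roots $\delta-\gamma$ with $\gamma$ a positive root of $\mathfrak g_n$. A basic ideal is an ideal $\mathfrak i$ of $\tilde{\mathfrak b}_n$ that is contained in $\tilde{\mathfrak n}_+$, has finite codimension, satisfies $\mathfrak i\cap\tilde{\mathfrak g}_\alpha\in\{0,\tilde{\mathfrak g}_\alpha\}$ for every positive root $\alpha$, and contains $\tilde{\mathfrak g}_\alpha$ for at least one $\alpha\in D$. Then there are only finitely many basic ideals, and their number $\tilde b_n$ is given by $$\tilde b_n=(3n+5)\,2^{2n-2}-2(3n-1)\binom{2n-2}{n-1}.$$ -/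

import Mathlib

open LieAlgebra

attribute [local instance 100] LieRing.ofAssociativeRing

noncomputable section

/-! ### The untwisted affine Lie algebra of a complex Lie algebra -/

/-- The untwisted affine Lie algebra `(𝔤 ⊗ ℂ[t,t⁻¹]) ⊕ ℂ c ⊕ ℂ d` attached to a complex Lie algebra
`𝔤`. An element is written as a loop together with its coefficients at `c` and at `d`. -/
@[ext]
structure UntwistedAffine (𝔤 : Type*) [LieRing 𝔤] [LieAlgebra ℂ 𝔤] where
  loop : loopAlgebra ℂ ℤ 𝔤
  central : ℂ
  deg : ℂ

namespace UntwistedAffine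

variable {𝔤 : Type*} [LieRing 𝔤] [LieAlgebra ℂ 𝔤]

/-- The loop `x ⊗ t ^ m`. -/
def loopMonomial (m : ℤ) (x : 𝔤) : loopAlgebra ℂ ℤ 𝔤 :=
  (LoopAlgebra.toFinsupp ℂ ℤ 𝔤).symm (Finsupp.single m x)

/-- The degree derivation `t · d/dt` of the loop algebra: `x ⊗ t ^ m ↦ m (x ⊗ t ^ m)`. -/
def loopDeriv : loopAlgebra ℂ ℤ 𝔤 →ₗ[ℂ] loopAlgebra ℂ ℤ 𝔤 :=
  (LoopAlgebra.toFinsupp ℂ ℤ 𝔤).symm.toLinearMap ∘ₗ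
    (Finsupp.lsum ℂ fun m : ℤ => (m : ℂ) • Finsupp.lsingle m) ∘ₗ
      (LoopAlgebra.toFinsupp ℂ ℤ 𝔤).toLinearMap

/-- The central cocycle: `(x ⊗ t ^ m, y ⊗ t ^ k) ↦ m (x | y) δ_{m + k, 0}`, where `( · | · )` is the
Killing form. -/
def loopCocycle : loopAlgebra ℂ ℤ 𝔤 →ₗ[ℂ] loopAlgebra ℂ ℤ 𝔤 →ₗ[ℂ] ℂ :=
  (LoopAlgebra.residuePairing ℂ ℤ 𝔤 (killingForm ℂ 𝔤)).flip

lemma loop_ext {M : Type*} [AddCommGroup M] [Module ℂ M] {f g : loopAlgebra ℂ ℤ 𝔤 →ₗ[ℂ] M}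
    (h : ∀ m x, f (loopMonomial m x) = g (loopMonomial m x)) : f = g := by
  ext1
  ext m x
  have := h m x
  simpa [loopMonomial] using this

lemma loopDeriv_monomial (m : ℤ) (x : 𝔤) :
    loopDeriv (loopMonomial m x) = (m : ℂ) • loopMonomial m x := by
  have h : loopDeriv (loopMonomial m x) = (LoopAlgebra.toFinsupp ℂ ℤ 𝔤).symm
      (Finsupp.lsum ℂ (fun m : ℤ => (m : ℂ) • Finsupp.lsingle m)
        (LoopAlgebra.toFinsupp ℂ ℤ 𝔤 ((LoopAlgebra.toFinsupp ℂ ℤ 𝔤).symm (Finsupp.single m x)))) := rfl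
  rw [h, LinearEquiv.apply_symm_apply, Finsupp.lsum_single, LinearMap.smul_apply,
    Finsupp.lsingle_apply, map_smul]
  rfl

lemma loopCocycle_apply (f g : loopAlgebra ℂ ℤ 𝔤) :
    loopCocycle f g = LoopAlgebra.residuePairing ℂ ℤ 𝔤 (killingForm ℂ 𝔤) g f := rfl

lemma loopCocycle_monomial (m k : ℤ) (x y : 𝔤) :
    loopCocycle (loopMonomial m x) (loopMonomial k y) =
      if m + k = 0 then (m : ℂ) * killingForm ℂ 𝔤 x y else 0 := by
  rw [loopCocycle_apply, LoopAlgebra.residuePairing_apply_apply, loopMonomial, loopMonomial,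
    LinearEquiv.apply_symm_apply, LinearEquiv.apply_symm_apply, Finsupp.sum_single_index (by simp), Finsupp.single_apply]
  by_cases h : m + k = 0
  · rw [if_pos (by grind), if_pos h, LieModule.traceForm_comm, zsmul_eq_mul]
  · rw [if_neg (by grind), if_neg h]
    simp

lemma lie_monomial (m k : ℤ) (x y : 𝔤) :
    ⁅loopMonomial m x, loopMonomial k y⁆ = loopMonomial (m + k) ⁅x, y⁆ := by
  simp only [loopMonomial, LoopAlgebra.toFinsupp_symm_single]
  rw [LieAlgebra.ExtendScalars.bracket_tmul, AddMonoidAlgebra.single_mul_single, one_mul]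

lemma loopDeriv_lie (f g : loopAlgebra ℂ ℤ 𝔤) :
    loopDeriv ⁅f, g⁆ = ⁅loopDeriv f, g⁆ + ⁅f, loopDeriv g⁆ := by
  have key : (LieModule.toEnd ℂ (loopAlgebra ℂ ℤ 𝔤) (loopAlgebra ℂ ℤ 𝔤)).toLinearMap.compr₂
      loopDeriv =
      (LieModule.toEnd ℂ (loopAlgebra ℂ ℤ 𝔤) (loopAlgebra ℂ ℤ 𝔤)).toLinearMap ∘ₗ loopDeriv +
      (LieModule.toEnd ℂ (loopAlgebra ℂ ℤ 𝔤) (loopAlgebra ℂ ℤ 𝔤)).toLinearMap.compl₂ loopDeriv := by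
    refine loop_ext fun m x => loop_ext fun k y => ?_
    simp [loopDeriv_monomial, lie_monomial, add_smul]
  simpa using LinearMap.congr_fun₂ key f g

lemma loopCocycle_self (f : loopAlgebra ℂ ℤ 𝔤) : loopCocycle f f = 0 :=
  (TrivialLieModule.equiv ℂ (loopAlgebra ℂ ℤ 𝔤) ℂ).symm.map_eq_zero_iff.mp <|
    LieModule.Cohomology.mem_twoCochain_iff.mp (LoopAlgebra.twoCochainOfBilinear ℂ ℤ 𝔤
      (killingForm ℂ 𝔤) ⟨LieModule.traceForm_comm ℂ 𝔤 𝔤⟩).2 f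

lemma loopCocycle_lie (f g h : loopAlgebra ℂ ℤ 𝔤) :
    loopCocycle f ⁅g, h⁆ = loopCocycle ⁅f, g⁆ h + loopCocycle g ⁅f, h⁆ := by
  have hs : ∀ f g : loopAlgebra ℂ ℤ 𝔤,
      LoopAlgebra.residuePairing ℂ ℤ 𝔤 (killingForm ℂ 𝔤) f g = - loopCocycle f g := by
    intro f g
    have h := loopCocycle_self (f + g)
    simp only [map_add, LinearMap.add_apply, loopCocycle_self] at h
    rw [← loopCocycle_apply]
    linear_combination h
  have key := (LieModule.Cohomology.mem_twoCocycle_iff_of_trivial _ _ _ _).mp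
    (LoopAlgebra.twoCocycleOfBilinear ℂ ℤ 𝔤 (killingForm ℂ 𝔤)
      (LieModule.traceForm_lieInvariant ℂ 𝔤 𝔤) ⟨LieModule.traceForm_comm ℂ 𝔤 𝔤⟩).2 f g h
  have key' : LoopAlgebra.residuePairing ℂ ℤ 𝔤 (killingForm ℂ 𝔤) f ⁅g, h⁆ =
      LoopAlgebra.residuePairing ℂ ℤ 𝔤 (killingForm ℂ 𝔤) ⁅f, g⁆ h +
      LoopAlgebra.residuePairing ℂ ℤ 𝔤 (killingForm ℂ 𝔤) g ⁅f, h⁆ := key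
  simp only [hs] at key'
  linear_combination -key'

lemma loopCocycle_deriv (f g : loopAlgebra ℂ ℤ 𝔤) :
    loopCocycle (loopDeriv f) g + loopCocycle f (loopDeriv g) = 0 := by
  have key : loopCocycle ∘ₗ loopDeriv + loopCocycle.compl₂ loopDeriv =
      (0 : loopAlgebra ℂ ℤ 𝔤 →ₗ[ℂ] loopAlgebra ℂ ℤ 𝔤 →ₗ[ℂ] ℂ) := by
    refine loop_ext fun m x => loop_ext fun k y => ?_
    by_cases h : m + k = 0
    · obtain rfl : k = -m := by grind
      simp [loopDeriv_monomial, loopCocycle_monomial]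
    · simp [loopDeriv_monomial, loopCocycle_monomial, h]
  simpa using LinearMap.congr_fun₂ key f g

section Axioms

variable {L : Type*} [LieRing L] [LieAlgebra ℂ L] (D : L →ₗ[ℂ] L) (ω : L →ₗ[ℂ] L →ₗ[ℂ] ℂ)

lemma aux_add_lie (f g h : L) (a b e : ℂ) :
    ⁅f + g, h⁆ + (a + b) • D h - e • D (f + g) =
      (⁅f, h⁆ + a • D h - e • D f) + (⁅g, h⁆ + b • D h - e • D g) := by
  simp only [add_lie, add_smul, map_add, smul_add]
  abel

lemma aux_lie_add (f g h : L) (a b e : ℂ) :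
    ⁅f, g + h⁆ + a • D (g + h) - (b + e) • D f =
      (⁅f, g⁆ + a • D g - b • D f) + (⁅f, h⁆ + a • D h - e • D f) := by
  simp only [lie_add, add_smul, map_add, smul_add]
  abel

lemma aux_lie_smul (r : ℂ) (f g : L) (a b : ℂ) :
    ⁅f, r • g⁆ + a • D (r • g) - (r • b) • D f = r • (⁅f, g⁆ + a • D g - b • D f) := by
  simp only [lie_smul, map_smul, smul_add, smul_sub, smul_eq_mul, mul_smul, smul_comm r a]

lemma aux_leibniz (hD : ∀ f g, D ⁅f, g⁆ = ⁅D f, g⁆ + ⁅f, D g⁆) (f g h : L) (a b e : ℂ) :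
    ⁅f, ⁅g, h⁆ + b • D h - e • D g⁆ + a • D (⁅g, h⁆ + b • D h - e • D g) - (0 : ℂ) • D f =
      (⁅⁅f, g⁆ + a • D g - b • D f, h⁆ + (0 : ℂ) • D h - e • D (⁅f, g⁆ + a • D g - b • D f)) +
      (⁅g, ⁅f, h⁆ + a • D h - e • D f⁆ + b • D (⁅f, h⁆ + a • D h - e • D f) - (0 : ℂ) • D g) := by
  simp only [lie_add, lie_sub, add_lie, sub_lie, lie_smul, smul_lie, map_add, map_sub, map_smul, hD,
    smul_add, smul_sub, zero_smul, leibniz_lie f g h, smul_comm a b, smul_comm a e, smul_comm b e,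
    ← lie_skew (D f) g]
  simp only [smul_neg]
  abel

lemma aux_cocycle (hω : ∀ f g h, ω f ⁅g, h⁆ = ω ⁅f, g⁆ h + ω g ⁅f, h⁆)
    (hωs : ∀ f, ω f f = 0) (hDω : ∀ f g, ω (D f) g + ω f (D g) = 0)
    (f g h : L) (a b e : ℂ) :
    ω f (⁅g, h⁆ + b • D h - e • D g) =
      ω (⁅f, g⁆ + a • D g - b • D f) h + ω g (⁅f, h⁆ + a • D h - e • D f) := by
  have h1 := hDω g h
  have h2 := hDω f h
  have h3 := hDω f g
  have h4 : ω g (D f) = - ω (D f) g := by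
    have := hωs (g + D f)
    simp only [map_add, LinearMap.add_apply, hωs] at this
    linear_combination this
  simp only [map_add, map_sub, map_smul, LinearMap.add_apply, LinearMap.sub_apply,
    LinearMap.smul_apply, smul_eq_mul, hω f g h, h4]
  linear_combination b * h2 - a * h1 - e * h3

end Axioms

/-- The underlying vector space is a direct sum. -/
def toProd : UntwistedAffine 𝔤 ≃ loopAlgebra ℂ ℤ 𝔤 × ℂ × ℂ where
  toFun x := ⟨x.loop, x.central, x.deg⟩
  invFun x := ⟨x.1, x.2.1, x.2.2⟩
  left_inv _ := rfl
  right_inv _ := rfl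

instance : AddCommGroup (UntwistedAffine 𝔤) := toProd.addCommGroup

instance : Module ℂ (UntwistedAffine 𝔤) := toProd.module ℂ

/-- `⁅f + λ c + a d, g + μ c + b d⁆ = ⁅f, g⁆ + a (t g') - b (t f') + ω(f, g) c`, with `ω` the central
cocycle; `c` is central and `⁅d, x ⊗ t ^ m⁆ = m (x ⊗ t ^ m)`. -/
instance : Bracket (UntwistedAffine 𝔤) (UntwistedAffine 𝔤) where
  bracket x y :=
    ⟨⁅x.loop, y.loop⁆ + x.deg • loopDeriv y.loop - y.deg • loopDeriv x.loop,
      loopCocycle x.loop y.loop, 0⟩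

lemma zero_eq_mk : (0 : UntwistedAffine 𝔤) = ⟨0, 0, 0⟩ := rfl

lemma add_eq_mk (x y : UntwistedAffine 𝔤) :
    x + y = ⟨x.loop + y.loop, x.central + y.central, x.deg + y.deg⟩ := rfl

lemma smul_eq_mk (a : ℂ) (x : UntwistedAffine 𝔤) :
    a • x = ⟨a • x.loop, a • x.central, a • x.deg⟩ := rfl

lemma lie_eq_mk (x y : UntwistedAffine 𝔤) :
    ⁅x, y⁆ = ⟨⁅x.loop, y.loop⁆ + x.deg • loopDeriv y.loop - y.deg • loopDeriv x.loop,
      loopCocycle x.loop y.loop, 0⟩ := rfl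

instance : LieRing (UntwistedAffine 𝔤) where
  add_lie _ _ _ := UntwistedAffine.ext (aux_add_lie _ _ _ _ _ _ _)
    (by rw [lie_eq_mk]; exact LinearMap.map_add₂ _ _ _ _) (add_zero _).symm
  lie_add x _ _ := UntwistedAffine.ext (aux_lie_add _ _ _ _ _ _ _)
    (map_add (loopCocycle x.loop) _ _) (add_zero _).symm
  lie_self x := UntwistedAffine.ext (by simp [lie_eq_mk, zero_eq_mk]) (loopCocycle_self _) rfl
  leibniz_lie _ _ _ := UntwistedAffine.ext (aux_leibniz _ loopDeriv_lie _ _ _ _ _ _)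
    (aux_cocycle _ _ loopCocycle_lie loopCocycle_self loopCocycle_deriv _ _ _ _ _ _)
    (add_zero _).symm

instance : LieAlgebra ℂ (UntwistedAffine 𝔤) where
  lie_smul _ x _ := UntwistedAffine.ext (aux_lie_smul _ _ _ _ _ _)
    (map_smul (loopCocycle x.loop) _ _) (smul_zero _).symm

/-- The element `x ⊗ t ^ m`. -/
def monomial (m : ℤ) (x : 𝔤) : UntwistedAffine 𝔤 := ⟨loopMonomial m x, 0, 0⟩

/-- The central element. -/
def c : UntwistedAffine 𝔤 := ⟨0, 1, 0⟩

/-- The degree derivation. -/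
def d : UntwistedAffine 𝔤 := ⟨0, 0, 1⟩

lemma lie_c (x : UntwistedAffine 𝔤) : ⁅x, (c : UntwistedAffine 𝔤)⁆ = 0 :=
  UntwistedAffine.ext (by simp [lie_eq_mk, zero_eq_mk, c]; exact @lie_zero (loopAlgebra ℂ ℤ 𝔤) (loopAlgebra ℂ ℤ 𝔤) _ _ _ _)
    (by simp [lie_eq_mk, zero_eq_mk, c]) rfl

lemma d_lie_monomial (m : ℤ) (x : 𝔤) :
    ⁅(d : UntwistedAffine 𝔤), monomial m x⁆ = (m : ℂ) • monomial m x :=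
  UntwistedAffine.ext
    (by simp [lie_eq_mk, smul_eq_mk, d, monomial, loopDeriv_monomial]; exact @zero_lie (loopAlgebra ℂ ℤ 𝔤) (loopAlgebra ℂ ℤ 𝔤) _ _ _ _)
    (by simp [lie_eq_mk, smul_eq_mk, d, monomial]) (smul_zero _).symm

lemma monomial_lie_monomial (m k : ℤ) (x y : 𝔤) :
    ⁅monomial m x, monomial k y⁆ =
      monomial (m + k) ⁅x, y⁆ + (if m + k = 0 then (m : ℂ) * killingForm ℂ 𝔤 x y else 0) • c := by
  rw [← loopCocycle_monomial]
  exact UntwistedAffine.ext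
    (by simp [lie_eq_mk, add_eq_mk, smul_eq_mk, c, monomial, lie_monomial])
    (by simp [lie_eq_mk, add_eq_mk, smul_eq_mk, c, monomial])
    (by simp [lie_eq_mk, add_eq_mk, smul_eq_mk, c, monomial])

end UntwistedAffine

/-! ### Type `B` -/

namespace TypeB

open UntwistedAffine

/-- The simple Lie algebra of type `B_n`: complex matrices of size `2n + 1` that are skew-adjoint for
the symmetric form with matrix `JB`, in a basis `u_0`, `u_1, …, u_n`, `u_{-1}, …, u_{-n}`. -/
abbrev SoB (n : ℕ) : LieSubalgebra ℂ (Matrix (Unit ⊕ Fin n ⊕ Fin n) (Unit ⊕ Fin n ⊕ Fin n) ℂ) :=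
  Orthogonal.typeB (Fin n) ℂ

/-- The order `u_1, …, u_n, u_0, u_{-n}, …, u_{-1}` of the basis in which the positive root vectors
are upper triangular. -/
def basisPos {n : ℕ} : Unit ⊕ Fin n ⊕ Fin n → ℕ
  | Sum.inl _ => n
  | Sum.inr (Sum.inl i) => i
  | Sum.inr (Sum.inr i) => 2 * n - i

/-- The Cartan subalgebra `𝔥`: diagonal matrices. -/
def finCartan (n : ℕ) : Submodule ℂ (SoB n) where
  carrier := {A | ∀ p q, p ≠ q → A.1 p q = 0}
  add_mem' hA hB p q h := by simp [hA p q h, hB p q h]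
  zero_mem' p q _ := rfl
  smul_mem' a A hA p q h := by simp [hA p q h]

/-- The nilpotent subalgebra `𝔫₊`: strictly upper triangular matrices for the order `basisPos`. -/
def finNilPlus (n : ℕ) : Submodule ℂ (SoB n) where
  carrier := {A | ∀ p q, basisPos q ≤ basisPos p → A.1 p q = 0}
  add_mem' hA hB p q h := by simp [hA p q h, hB p q h]
  zero_mem' p q _ := rfl
  smul_mem' a A hA p q h := by simp [hA p q h]

lemma coe_lie_apply {n : ℕ} (A B : SoB n) (p q : Unit ⊕ Fin n ⊕ Fin n) :
    (⁅A, B⁆ : SoB n).1 p q = ∑ r, A.1 p r * B.1 r q - ∑ r, B.1 p r * A.1 r q := by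
  rw [LieSubalgebra.coe_bracket, Ring.lie_def]
  simp [Matrix.mul_apply]

lemma lie_finCartan {n : ℕ} {A B : SoB n} (hA : A ∈ finCartan n) (hB : B ∈ finCartan n) :
    ⁅A, B⁆ = 0 := by
  apply Subtype.ext
  ext p q
  rw [coe_lie_apply, Finset.sum_eq_single p, Finset.sum_eq_single q]
  · by_cases h : p = q
    · subst h; simp [mul_comm]
    · simp [hB p q h]
  · intro r _ hr; simp [hA r q hr]
  · simp
  · intro r _ hr; simp [hA p r hr.symm]
  · simp

lemma lie_mem_finNilPlus_of_cartan {n : ℕ} {A B : SoB n} (hA : A ∈ finCartan n)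
    (hB : B ∈ finNilPlus n) : ⁅A, B⁆ ∈ finNilPlus n := by
  intro p q h
  rw [coe_lie_apply, Finset.sum_eq_single p, Finset.sum_eq_single q]
  · simp [hB p q h]
  · intro r _ hr; simp [hA r q hr]
  · simp
  · intro r _ hr; simp [hA p r hr.symm]
  · simp

lemma lie_mem_finNilPlus {n : ℕ} {A B : SoB n} (hA : A ∈ finNilPlus n) (hB : B ∈ finNilPlus n) :
    ⁅A, B⁆ ∈ finNilPlus n := by
  intro p q h
  rw [coe_lie_apply, Finset.sum_eq_zero, Finset.sum_eq_zero, sub_zero]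
  all_goals
    intro r _
    rcases le_total (basisPos r) (basisPos p) with hr | hr
    · simp [hA p r hr, hB p r hr]
    · simp [hA r q (h.trans hr), hB r q (h.trans hr)]

/-- The untwisted affine Lie algebra of type `B̃_n`. -/
abbrev AffineB (n : ℕ) := UntwistedAffine (SoB n)

/-- `𝔥̃ = Span ({c, d} ∪ {h ⊗ 1 | h ∈ 𝔥})`. -/
def affineCartan (n : ℕ) : Submodule ℂ (AffineB n) :=
  Submodule.span ℂ ({c, d} ∪ {y | ∃ h ∈ finCartan n, y = monomial 0 h})

/-- `𝔫̃₊ = Span ({x ⊗ 1 | x ∈ 𝔫₊} ∪ {x ⊗ t ^ k | x ∈ 𝔤, k > 0})`. -/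
def affineNilPlus (n : ℕ) : Submodule ℂ (AffineB n) :=
  Submodule.span ℂ ({y | ∃ x ∈ finNilPlus n, y = monomial 0 x} ∪
    {y | ∃ (k : ℤ) (x : SoB n), 0 < k ∧ y = monomial k x})

/-- `𝔟̃ = 𝔥̃ ⊕ 𝔫̃₊` is closed under the bracket. -/
lemma lie_mem_borel (n : ℕ) {x y : AffineB n} (hx : x ∈ affineCartan n ⊔ affineNilPlus n)
    (hy : y ∈ affineCartan n ⊔ affineNilPlus n) : ⁅x, y⁆ ∈ affineCartan n ⊔ affineNilPlus n := by
  have mH : ∀ h ∈ finCartan n, monomial 0 h ∈ affineCartan n ⊔ affineNilPlus n := fun h hh =>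
    Submodule.mem_sup_left (Submodule.subset_span (Or.inr ⟨h, hh, rfl⟩))
  have mN : ∀ h ∈ finNilPlus n, monomial 0 h ∈ affineCartan n ⊔ affineNilPlus n := fun h hh =>
    Submodule.mem_sup_right (Submodule.subset_span (Or.inl ⟨h, hh, rfl⟩))
  have mP : ∀ (k : ℤ) (x : SoB n), 0 < k → monomial k x ∈ affineCartan n ⊔ affineNilPlus n :=
    fun k x hk =>
    Submodule.mem_sup_right (Submodule.subset_span (Or.inr ⟨k, x, hk, rfl⟩))
  have lie_d : ∀ (m : ℤ) (x : SoB n), monomial m x ∈ affineCartan n ⊔ affineNilPlus n →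
      ⁅monomial m x, (d : AffineB n)⁆ ∈ affineCartan n ⊔ affineNilPlus n := fun m x hx => by
    rw [← lie_skew, d_lie_monomial]
    exact neg_mem (Submodule.smul_mem _ _ hx)
  have lie_m : ∀ (m k : ℤ) (x y : SoB n), 0 ≤ m → 0 ≤ k →
      monomial (m + k) ⁅x, y⁆ ∈ affineCartan n ⊔ affineNilPlus n →
      ⁅monomial m x, monomial k y⁆ ∈ affineCartan n ⊔ affineNilPlus n := fun m k x y hm hk h => by
    have h0 : (if m + k = 0 then (m : ℂ) * killingForm ℂ (SoB n) x y else 0) = 0 := by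
      split_ifs with hmk
      · obtain rfl : m = 0 := by lia
        simp
      · rfl
    rwa [monomial_lie_monomial, h0, zero_smul, add_zero]
  rw [affineCartan, affineNilPlus, ← Submodule.span_union] at hx hy
  induction hx using Submodule.span_induction with
  | zero => rw [zero_lie]; exact zero_mem _
  | add x x' _ _ h h' => rw [add_lie]; exact add_mem h h'
  | smul a x _ h => rw [smul_lie]; exact Submodule.smul_mem _ _ h
  | mem x hx =>
    induction hy using Submodule.span_induction with
    | zero => rw [lie_zero]; exact zero_mem _
    | add y y' _ _ h h' => rw [lie_add]; exact add_mem h h'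
    | smul a y _ h => rw [lie_smul]; exact Submodule.smul_mem _ _ h
    | mem y hy =>
      rcases hy with ((rfl | rfl) | ⟨B, hB, rfl⟩) | (⟨B, hB, rfl⟩ | ⟨k, B, hk, rfl⟩)
      · rw [lie_c]; exact zero_mem _
      · rcases hx with ((rfl | rfl) | ⟨A, hA, rfl⟩) | (⟨A, hA, rfl⟩ | ⟨m, A, hm, rfl⟩)
        · rw [← lie_skew, lie_c, neg_zero]; exact zero_mem _
        · rw [lie_self]; exact zero_mem _
        · exact lie_d _ _ (mH _ hA)
        · exact lie_d _ _ (mN _ hA)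
        · exact lie_d _ _ (mP _ _ hm)
      · rcases hx with ((rfl | rfl) | ⟨A, hA, rfl⟩) | (⟨A, hA, rfl⟩ | ⟨m, A, hm, rfl⟩)
        · rw [← lie_skew, lie_c, neg_zero]; exact zero_mem _
        · rw [d_lie_monomial]; exact Submodule.smul_mem _ _ (mH _ hB)
        · refine lie_m _ _ _ _ le_rfl le_rfl ?_
          rw [lie_finCartan hA hB]; exact mH _ (zero_mem _)
        · refine lie_m _ _ _ _ le_rfl le_rfl (mN _ ?_)
          rw [← lie_skew]; exact neg_mem (lie_mem_finNilPlus_of_cartan hB hA)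
        · exact lie_m _ _ _ _ hm.le le_rfl (mP _ _ (by lia))
      · rcases hx with ((rfl | rfl) | ⟨A, hA, rfl⟩) | (⟨A, hA, rfl⟩ | ⟨m, A, hm, rfl⟩)
        · rw [← lie_skew, lie_c, neg_zero]; exact zero_mem _
        · rw [d_lie_monomial]; exact Submodule.smul_mem _ _ (mN _ hB)
        · exact lie_m _ _ _ _ le_rfl le_rfl (mN _ (lie_mem_finNilPlus_of_cartan hA hB))
        · exact lie_m _ _ _ _ le_rfl le_rfl (mN _ (lie_mem_finNilPlus hA hB))
        · exact lie_m _ _ _ _ hm.le le_rfl (mP _ _ (by lia))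
      · rcases hx with ((rfl | rfl) | ⟨A, hA, rfl⟩) | (⟨A, hA, rfl⟩ | ⟨m, A, hm, rfl⟩)
        · rw [← lie_skew, lie_c, neg_zero]; exact zero_mem _
        · rw [d_lie_monomial]; exact Submodule.smul_mem _ _ (mP _ _ hk)
        · exact lie_m _ _ _ _ le_rfl hk.le (mP _ _ (by lia))
        · exact lie_m _ _ _ _ le_rfl hk.le (mP _ _ (by lia))
        · exact lie_m _ _ _ _ hm.le hk.le (mP _ _ (by lia))

/-- The Borel subalgebra `𝔟̃ = 𝔥̃ ⊕ 𝔫̃₊`. -/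
def affineBorel (n : ℕ) : LieSubalgebra ℂ (AffineB n) where
  toSubmodule := affineCartan n ⊔ affineNilPlus n
  lie_mem' := lie_mem_borel n

/-- The root space `{x | ⁅h, x⁆ = α(h) x for all h ∈ 𝔥̃}` of `α ∈ 𝔥̃*`. -/
def affineRootSpace (n : ℕ) (α : Module.Dual ℂ (affineCartan n)) : Submodule ℂ (AffineB n) where
  carrier := {x | ∀ h : affineCartan n, ⁅(h : AffineB n), x⁆ = α h • x}
  add_mem' hx hy h := by rw [lie_add, hx h, hy h, smul_add]
  zero_mem' h := by rw [lie_zero, smul_zero]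
  smul_mem' a x hx h := by rw [lie_smul, hx h, smul_comm]

/-- A positive root: a nonzero `α ∈ 𝔥̃*` whose root space is nonzero and lies in `𝔫̃₊`. -/
def IsPosRoot (n : ℕ) (α : Module.Dual ℂ (affineCartan n)) : Prop :=
  α ≠ 0 ∧ affineRootSpace n α ≠ ⊥ ∧ affineRootSpace n α ≤ affineNilPlus n

/-- The functional `e_i`, which takes the `i`-th diagonal entry of the part in `𝔥 ⊗ 1` and vanishes
on `c` and `d`. -/
def eps (n : ℕ) (i : Fin n) : Module.Dual ℂ (affineCartan n) where
  toFun h := (LoopAlgebra.toFinsupp ℂ ℤ (SoB n) h.1.loop 0).1 (Sum.inr (Sum.inl i))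
    (Sum.inr (Sum.inl i))
  map_add' x y := by simp [add_eq_mk]
  map_smul' a x := by simp [smul_eq_mk]

/-- The indivisible positive imaginary root `δ`: it takes the coefficient at `d`. -/
def delta (n : ℕ) : Module.Dual ℂ (affineCartan n) where
  toFun h := h.1.deg
  map_add' _ _ := rfl
  map_smul' _ _ := rfl

/-- The positive roots of `B_n`: `e_i`, and `e_i - e_j`, `e_i + e_j` for `i < j`. -/
def finPosRoots (n : ℕ) : Set (Module.Dual ℂ (affineCartan n)) :=
  {γ | (∃ i, γ = eps n i) ∨
    ∃ i j, i < j ∧ (γ = eps n i - eps n j ∨ γ = eps n i + eps n j)}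

/-- The set `D` consisting of `δ`, of the positive roots of `B_n`, and of the roots `δ + γ` with `γ`
a negative root of `B_n`. -/
def fundamentalRoots (n : ℕ) : Set (Module.Dual ℂ (affineCartan n)) :=
  {delta n} ∪ finPosRoots n ∪ {β | ∃ γ ∈ finPosRoots n, β = delta n - γ}

/-- An ideal of `𝔟̃`, as a subspace of the affine Lie algebra. -/
def ambient {n : ℕ} (I : LieIdeal ℂ (affineBorel n)) : Submodule ℂ (AffineB n) :=
  I.toSubmodule.map (affineBorel n).toSubmodule.subtype

/-- A combinatorial ideal: an ideal of `𝔟̃` contained in `𝔫̃₊`, of finite codimension, which meets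
the root space of each positive root in `0` or in the whole root space. -/
def IsCombinatorialIdeal {n : ℕ} (I : LieIdeal ℂ (affineBorel n)) : Prop :=
  ambient I ≤ affineNilPlus n ∧
  FiniteDimensional ℂ (affineBorel n ⧸ I.toSubmodule) ∧
  ∀ α, IsPosRoot n α →
    ambient I ⊓ affineRootSpace n α = ⊥ ∨ ambient I ⊓ affineRootSpace n α = affineRootSpace n α

/-- The support: the set of positive roots whose root spaces are contained in the ideal. -/
def idealSupport {n : ℕ} (I : LieIdeal ℂ (affineBorel n)) : Set (Module.Dual ℂ (affineCartan n)) :=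
  {α | IsPosRoot n α ∧ affineRootSpace n α ≤ ambient I}

/-- A basic ideal: a combinatorial ideal whose support meets `D`. -/
def IsBasicIdeal {n : ℕ} (I : LieIdeal ℂ (affineBorel n)) : Prop :=
  IsCombinatorialIdeal I ∧ (idealSupport I ∩ fundamentalRoots n).Nonempty

end TypeB

end

/-! A basic ideal contains the whole root space of `δ`. If it contains the root space of `γ` or of
`δ - γ`, bracketing root vectors of these two roots gives a nonzero vector of weight `δ`, and the
ideal meets that root space in zero or in everything (`rootSpace_delta_le`). Brackets with this root
space then yield everything of degree at least 2 in `t` and all roots `δ + γ` with `γ` positive.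
What remains free is the set `A` of positive roots in the support and the set `C` of positive roots
`γ` with `δ - γ` outside it.

Stability under `𝔫₊` makes `A` and `C` upper sets of the root poset. Stability under degree one says
that no `α ∈ A` and `γ ∈ C` have a root as their sum, since bracketing `α` with `δ - α - γ` produces
`δ - γ`. As both sets are upper sets, it is enough to exclude sums equal to the highest root
(`IsCommutingPair.not_full`). Conversely, every such pair defines a basic ideal, so basic ideals
biject with commuting pairs (`bijOn_basicIdeals`).

To count, a positive root is read as a matrix position `(i, q)` with `i < q` and `i + q < 2n`, rows
numbered from 0. An upper set with `k` roots in row 0 is determined by the rest, an upper set for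
`B_{n-1}` with fewer than `k` roots (or none) in its own first row; this is the recursion for
`upperCount`. Sums to the highest root involve only rows 0 and 1. Once the sizes of both rows 0 are
fixed, the two remaining upper sets therefore vary independently, and the count is a double sum of
products (`encard_commutingPairs`). The recursion is solved by powers of 2 corrected by tails of
binomial sums (`upperCount_eq`). The double sum folds into two triangular sums
(`sum_square_eq_triangles`), which reduce to first moments of binomial tails and hence to a closed
form (`sum_upperCount`). -/

/-! ### Coefficients of elements of the affine Lie algebra -/

noncomputable section

namespace UntwistedAffine

variable {𝔤 : Type*} [LieRing 𝔤] [LieAlgebra ℂ 𝔤]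

/-- The coefficient of an element at `t ^ k`. -/
def coeff (k : ℤ) : UntwistedAffine 𝔤 →ₗ[ℂ] 𝔤 where
  toFun x := LoopAlgebra.toFinsupp ℂ ℤ 𝔤 x.loop k
  map_add' x y := by simp [add_eq_mk]
  map_smul' a x := by simp [smul_eq_mk]

/-- The coefficient at `c`, as a linear functional. -/
def centralₗ : UntwistedAffine 𝔤 →ₗ[ℂ] ℂ where
  toFun x := x.central
  map_add' _ _ := rfl
  map_smul' _ _ := rfl

/-- The coefficient at `d`, as a linear functional. -/
def degₗ : UntwistedAffine 𝔤 →ₗ[ℂ] ℂ where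
  toFun x := x.deg
  map_add' _ _ := rfl
  map_smul' _ _ := rfl

/-- The map `x ↦ x ⊗ t ^ m`, as a linear map. -/
def monomialₗ (m : ℤ) : 𝔤 →ₗ[ℂ] UntwistedAffine 𝔤 where
  toFun x := monomial m x
  map_add' x y := by ext1 <;> simp [monomial, add_eq_mk, loopMonomial]
  map_smul' a x := by ext1 <;> simp [monomial, smul_eq_mk, loopMonomial]

lemma monomial_smul (m : ℤ) (a : ℂ) (x : 𝔤) : monomial m (a • x) = a • monomial m x :=
  (monomialₗ m).map_smul a x

lemma monomial_zero (m : ℤ) : monomial m (0 : 𝔤) = 0 := (monomialₗ m).map_zero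

lemma monomial_sum {ι : Type*} (s : Finset ι) (m : ℤ) (f : ι → 𝔤) :
    monomial m (∑ i ∈ s, f i) = ∑ i ∈ s, monomial m (f i) := map_sum (monomialₗ m) f s

lemma coeff_eq (k : ℤ) (x : UntwistedAffine 𝔤) :
    coeff k x = LoopAlgebra.toFinsupp ℂ ℤ 𝔤 x.loop k := rfl

lemma coeff_monomial (k m : ℤ) (x : 𝔤) :
    coeff k (monomial m x) = if m = k then x else 0 := by
  simp only [coeff_eq, monomial, loopMonomial, LinearEquiv.apply_symm_apply, Finsupp.single_apply]

lemma coeff_c (k : ℤ) : coeff k (c : UntwistedAffine 𝔤) = 0 := by simp [coeff_eq, c]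

lemma coeff_d (k : ℤ) : coeff k (d : UntwistedAffine 𝔤) = 0 := by simp [coeff_eq, d]

lemma ext_coeff {x y : UntwistedAffine 𝔤} (h : ∀ k, coeff k x = coeff k y)
    (hc : x.central = y.central) (hd : x.deg = y.deg) : x = y := by
  ext1
  · exact (LoopAlgebra.toFinsupp ℂ ℤ 𝔤).injective (Finsupp.ext h)
  · exact hc
  · exact hd

lemma exists_finset_coeff_eq_zero (x : UntwistedAffine 𝔤) :
    ∃ s : Finset ℤ, ∀ k ∉ s, coeff k x = 0 :=
  ⟨(LoopAlgebra.toFinsupp ℂ ℤ 𝔤 x.loop).support, fun _ hk => Finsupp.notMem_support_iff.mp hk⟩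

lemma coeff_sum_monomial (s : Finset ℤ) (f : ℤ → 𝔤) (k : ℤ) :
    coeff k (∑ m ∈ s, monomial m (f m)) = if k ∈ s then f k else 0 := by
  simp [map_sum, coeff_monomial]

/-- An element with no components at `c` and `d` is the sum of its monomials. -/
lemma eq_sum_monomial {x : UntwistedAffine 𝔤} (hc : x.central = 0) (hd : x.deg = 0) {s : Finset ℤ}
    (hs : ∀ k ∉ s, coeff k x = 0) : x = ∑ k ∈ s, monomial k (coeff k x) := by
  refine ext_coeff (fun k => ?_) ?_ ?_
  · rw [coeff_sum_monomial]
    split_ifs with h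
    · rfl
    · exact hs k h
  · have : (∑ k ∈ s, monomial k (coeff k x)).central = 0 := by
      change centralₗ _ = 0
      rw [map_sum]
      exact Finset.sum_eq_zero fun _ _ => rfl
    rw [hc, this]
  · have : (∑ k ∈ s, monomial k (coeff k x)).deg = 0 := by
      change degₗ _ = 0
      rw [map_sum]
      exact Finset.sum_eq_zero fun _ _ => rfl
    rw [hd, this]

lemma toFinsupp_monomial_lie (m k : ℤ) (a : 𝔤) (g : loopAlgebra ℂ ℤ 𝔤) :
    LoopAlgebra.toFinsupp ℂ ℤ 𝔤 ⁅loopMonomial m a, g⁆ k =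
      ⁅a, LoopAlgebra.toFinsupp ℂ ℤ 𝔤 g (k - m)⁆ := by
  have key : (Finsupp.lapply k ∘ₗ (LoopAlgebra.toFinsupp ℂ ℤ 𝔤).toLinearMap) ∘ₗ
      (LieModule.toEnd ℂ (loopAlgebra ℂ ℤ 𝔤) (loopAlgebra ℂ ℤ 𝔤) (loopMonomial m a)) =
      (LieModule.toEnd ℂ 𝔤 𝔤 a) ∘ₗ Finsupp.lapply (k - m) ∘ₗ
        (LoopAlgebra.toFinsupp ℂ ℤ 𝔤).toLinearMap := by
    refine loop_ext fun j y => ?_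
    simp only [LinearMap.comp_apply, LieModule.toEnd_apply_apply, lie_monomial]
    simp only [loopMonomial, LinearEquiv.coe_coe, LinearEquiv.apply_symm_apply,
      Finsupp.lapply_apply, Finsupp.single_apply]
    by_cases h : m + j = k
    · rw [if_pos h, if_pos (by lia)]
    · rw [if_neg h, if_neg (by lia), lie_zero]
  exact LinearMap.congr_fun key g

lemma toFinsupp_lie (f g : loopAlgebra ℂ ℤ 𝔤) (k : ℤ) :
    LoopAlgebra.toFinsupp ℂ ℤ 𝔤 ⁅f, g⁆ k =
      (LoopAlgebra.toFinsupp ℂ ℤ 𝔤 f).sum fun m a =>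
        ⁅a, LoopAlgebra.toFinsupp ℂ ℤ 𝔤 g (k - m)⁆ := by
  obtain ⟨F, rfl⟩ := (LoopAlgebra.toFinsupp ℂ ℤ 𝔤).symm.surjective f
  rw [LinearEquiv.apply_symm_apply]
  induction F using Finsupp.induction_linear with
  | zero =>
    rw [map_zero, Finsupp.sum_zero_index]
    have : ⁅(0 : loopAlgebra ℂ ℤ 𝔤), g⁆ = 0 := zero_lie g
    rw [this, map_zero, Finsupp.zero_apply]
  | add F G hF hG =>
    have h : ∀ a b : loopAlgebra ℂ ℤ 𝔤, ⁅a + b, g⁆ = ⁅a, g⁆ + ⁅b, g⁆ := fun a b => add_lie a b g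
    rw [map_add, h, map_add, Finsupp.add_apply, hF, hG, Finsupp.sum_add_index']
    · simp
    · simp
  | single m a =>
    rw [Finsupp.sum_single_index (by simp)]
    exact toFinsupp_monomial_lie m k a g

lemma toFinsupp_loopDeriv (f : loopAlgebra ℂ ℤ 𝔤) (k : ℤ) :
    LoopAlgebra.toFinsupp ℂ ℤ 𝔤 (loopDeriv f) k =
      (k : ℂ) • LoopAlgebra.toFinsupp ℂ ℤ 𝔤 f k := by
  have key : (Finsupp.lapply k ∘ₗ (LoopAlgebra.toFinsupp ℂ ℤ 𝔤).toLinearMap) ∘ₗ loopDeriv =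
      (k : ℂ) • (Finsupp.lapply k ∘ₗ (LoopAlgebra.toFinsupp ℂ ℤ 𝔤).toLinearMap) := by
    refine loop_ext fun j y => ?_
    simp only [LinearMap.comp_apply, loopDeriv_monomial, LinearMap.smul_apply, map_smul]
    simp only [loopMonomial, LinearEquiv.coe_coe, LinearEquiv.apply_symm_apply,
      Finsupp.lapply_apply, Finsupp.single_apply]
    by_cases h : j = k
    · rw [h]
    · simp [if_neg h]
  exact LinearMap.congr_fun key f

lemma finsupp_sum_eq_sum {M N : Type*} [AddCommMonoid M] [AddCommMonoid N] (F : ℤ →₀ M)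
    (φ : ℤ → M → N) (h0 : ∀ m, φ m 0 = 0) (s : Finset ℤ) (hs : ∀ m ∉ s, φ m (F m) = 0) :
    F.sum φ = ∑ m ∈ s, φ m (F m) := by
  rw [Finsupp.sum_of_support_subset F (s := F.support ∪ s) Finset.subset_union_left φ
    (fun m _ => h0 m)]
  exact (Finset.sum_subset Finset.subset_union_right fun m _ hm => hs m hm).symm

/-- Coefficients of a bracket are convolutions. Any finite `s` carrying the convolution is allowed,
so that for elements without negative degrees it can be taken to have at most two members in degrees
0 and 1. -/
lemma coeff_lie (x y : UntwistedAffine 𝔤) (k : ℤ) (s : Finset ℤ)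
    (hs : ∀ m ∉ s, ⁅coeff m x, coeff (k - m) y⁆ = 0) :
    coeff k ⁅x, y⁆ = ∑ m ∈ s, ⁅coeff m x, coeff (k - m) y⁆ +
      (x.deg * k) • coeff k y - (y.deg * k) • coeff k x := by
  have h : coeff k ⁅x, y⁆ = LoopAlgebra.toFinsupp ℂ ℤ 𝔤
    (⁅x.loop, y.loop⁆ + x.deg • loopDeriv y.loop - y.deg • loopDeriv x.loop) k := rfl
  rw [h, map_sub, map_add, map_smul, map_smul, Finsupp.sub_apply, Finsupp.add_apply,
    Finsupp.smul_apply, Finsupp.smul_apply, toFinsupp_loopDeriv, toFinsupp_loopDeriv, toFinsupp_lie,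
    finsupp_sum_eq_sum _ _ (by simp) s hs, smul_smul, smul_smul]
  rfl

/-- The cocycle pairs degree `m` with degree `-m` and carries the factor `m`, so degree 0 never
contributes. -/
lemma central_lie_eq_zero {x y : UntwistedAffine 𝔤}
    (h : ∀ m : ℤ, m ≠ 0 → coeff m x = 0 ∨ coeff (-m) y = 0) : (⁅x, y⁆ : UntwistedAffine 𝔤).central = 0 := by
  rw [lie_eq_mk, loopCocycle_apply, LoopAlgebra.residuePairing_apply_apply]
  refine Finset.sum_eq_zero fun m _ => ?_
  by_cases hm : m = 0
  · simp [hm]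
  · rcases h m hm with h | h
    · rw [coeff_eq] at h
      simp [h]
    · rw [coeff_eq] at h
      simp [h]

lemma deg_lie (x y : UntwistedAffine 𝔤) : (⁅x, y⁆ : UntwistedAffine 𝔤).deg = 0 := rfl

end UntwistedAffine
end

/-! ### Root vectors of `B_n` -/

noncomputable section

namespace TypeB

open UntwistedAffine

variable {n : ℕ}

/-- The index set of the basis `u_0`, `u_i`, `u_{-i}`. -/
abbrev Idx (n : ℕ) := Unit ⊕ Fin n ⊕ Fin n

/-- The involution `u_0 ↦ u_0`, `u_i ↔ u_{-i}` of the basis. -/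
def star : Idx n → Idx n
  | Sum.inl _ => Sum.inl ()
  | Sum.inr (Sum.inl i) => Sum.inr (Sum.inr i)
  | Sum.inr (Sum.inr i) => Sum.inr (Sum.inl i)

/-- The value of the symmetric form on `u_p` and `u_{-p}`. -/
def formWeight : Idx n → ℂ
  | Sum.inl _ => 2
  | Sum.inr _ => 1

@[simp] lemma star_star (p : Idx n) : star (star p) = p := by
  rcases p with _ | _ | _ <;> rfl

lemma star_injective : Function.Injective (star : Idx n → Idx n) :=
  Function.LeftInverse.injective star_star

lemma star_eq_iff {p q : Idx n} : star p = q ↔ p = star q :=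
  ⟨fun h => by rw [← h, star_star], fun h => by rw [h, star_star]⟩

@[simp] lemma formWeight_star (p : Idx n) : formWeight (star p) = formWeight p := by
  rcases p with _ | _ | _ <;> rfl

lemma formWeight_ne_zero (p : Idx n) : formWeight p ≠ 0 := by
  rcases p with _ | _ <;> simp [formWeight]

lemma basisPos_le (p : Idx n) : basisPos p ≤ 2 * n := by
  rcases p with _ | i | i <;> simp only [basisPos] <;> lia

lemma basisPos_star (p : Idx n) : basisPos (star p) = 2 * n - basisPos p := by
  rcases p with _ | i | i <;> simp only [basisPos, star] <;> lia

lemma basisPos_injective : Function.Injective (basisPos : Idx n → ℕ) := by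
  intro p q h
  rcases p with _ | i | i <;> rcases q with _ | j | j <;> simp only [basisPos] at h
  · rfl
  · lia
  · lia
  · lia
  · congr 2; exact Fin.ext h
  · lia
  · lia
  · lia
  · congr 2; exact Fin.ext (by lia)

lemma exists_basisPos_eq {k : ℕ} (h : k ≤ 2 * n) : ∃ p : Idx n, basisPos p = k := by
  rcases lt_trichotomy k n with hk | hk | hk
  · exact ⟨Sum.inr (Sum.inl ⟨k, hk⟩), rfl⟩
  · exact ⟨Sum.inl (), hk.symm⟩
  · refine ⟨Sum.inr (Sum.inr ⟨2 * n - k, by lia⟩), ?_⟩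
    simp only [basisPos]
    lia

lemma eq_star_iff {p q : Idx n} : q = star p ↔ basisPos p + basisPos q = 2 * n := by
  have := basisPos_le p
  rw [← basisPos_injective.eq_iff, basisPos_star]
  lia

lemma JB_apply (p q : Idx n) :
    Orthogonal.JB (Fin n) ℂ p q = if q = star p then formWeight p else 0 := by
  rcases p with _ | i | i <;> rcases q with _ | j | j <;>
    simp [Orthogonal.JB, Orthogonal.JD, star, formWeight, Matrix.one_apply, eq_comm]

/-- The form pairs each basis vector only with its image under `star`. Each entry of `Aᵀ J = -J A`
is thus a single product on either side, and it relates a position to its reflection in the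
antidiagonal. -/
lemma mem_soB_iff (A : Matrix (Idx n) (Idx n) ℂ) :
    A ∈ SoB n ↔ ∀ p q, formWeight q * A (star q) (star p) = -(formWeight p * A p q) := by
  rw [SoB, Orthogonal.typeB, mem_skewAdjointMatricesLieSubalgebra, mem_skewAdjointMatricesSubmodule,
    Matrix.IsSkewAdjoint, Matrix.IsAdjointPair, ← Matrix.ext_iff]
  have h1 : ∀ p q, (A.transpose * Orthogonal.JB (Fin n) ℂ) p q = A (star q) p * formWeight q := by
    intro p q
    rw [Matrix.mul_apply, Finset.sum_eq_single (star q)]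
    · simp [JB_apply]
    · intro r _ hr
      rw [JB_apply, if_neg, mul_zero]
      rintro rfl
      simp at hr
    · simp
  have h2 : ∀ p q, (Orthogonal.JB (Fin n) ℂ * -A) p q = -(formWeight p * A (star p) q) := by
    intro p q
    rw [Matrix.mul_apply, Finset.sum_eq_single (star p)]
    · simp [JB_apply]
    · intro r _ hr
      rw [JB_apply, if_neg hr, zero_mul]
    · simp
  simp only [h1, h2]
  constructor
  · intro h p q
    have := h (star p) q
    rw [star_star, formWeight_star] at this
    linear_combination this
  · intro h p q
    have := h (star p) q
    rw [star_star, formWeight_star] at this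
    linear_combination this

lemma entry_star (A : SoB n) (p q : Idx n) :
    formWeight q * A.1 (star q) (star p) = -(formWeight p * A.1 p q) :=
  (mem_soB_iff A.1).mp A.2 p q

lemma entry_star_eq_zero_iff (A : SoB n) (p q : Idx n) :
    A.1 (star q) (star p) = 0 ↔ A.1 p q = 0 := by
  have h := entry_star A p q
  have hp := formWeight_ne_zero p
  have hq := formWeight_ne_zero q
  constructor <;> intro h0 <;> rw [h0] at h <;> simp_all

/-- An antidiagonal position is its own reflection, so its entry equals its negative. This is why `2
e_i` is not a root. -/
lemma entry_antidiag (A : SoB n) (p : Idx n) : A.1 p (star p) = 0 := by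
  have h := entry_star A p (star p)
  rw [star_star, formWeight_star] at h
  have hp := formWeight_ne_zero p
  have : formWeight p * A.1 p (star p) = 0 := by linear_combination h / 2
  simpa [hp] using this

/-- The root vector of weight `e_p - e_q`. -/
def rootMat (p q : Idx n) : SoB n :=
  ⟨Matrix.single p q (formWeight q) - Matrix.single (star q) (star p) (formWeight p), by
    rw [mem_soB_iff]
    intro a b
    simp only [Matrix.sub_apply, Matrix.single_apply]
    by_cases h1 : p = a ∧ q = b
    · obtain ⟨rfl, rfl⟩ := h1
      by_cases h2 : p = star q
      · subst h2; simp
      · simp [h2, star_eq_iff, mul_comm]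
    · by_cases h2 : star q = a ∧ star p = b
      · obtain ⟨rfl, rfl⟩ := h2
        by_cases h3 : p = star q
        · subst h3; simp
        · simp [star_eq_iff, h3, mul_comm]
      · have h3 : ¬ (p = star b ∧ q = star a) := by
          rintro ⟨rfl, rfl⟩; simp at h2
        have h4 : ¬ (star q = star b ∧ star p = star a) := by
          rintro ⟨h, h'⟩; exact h1 ⟨star_injective h', star_injective h⟩
        simp [h1, h2, h3, h4]⟩

lemma rootMat_apply (p q a b : Idx n) : (rootMat p q).1 a b =
    (if p = a ∧ q = b then formWeight q else 0) -
      (if star q = a ∧ star p = b then formWeight p else 0) := by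
  simp only [rootMat, Matrix.sub_apply, Matrix.single_apply]

lemma rootMat_apply_self {p q : Idx n} (h : q ≠ star p) : (rootMat p q).1 p q = formWeight q := by
  rw [rootMat_apply, if_pos ⟨rfl, rfl⟩, if_neg, sub_zero]
  rintro ⟨-, h'⟩
  exact h h'.symm

lemma rootMat_apply_of_ne {p q a b : Idx n} (h1 : ¬ (p = a ∧ q = b))
    (h2 : ¬ (star q = a ∧ star p = b)) : (rootMat p q).1 a b = 0 := by
  rw [rootMat_apply, if_neg h1, if_neg h2, sub_zero]

lemma rootMat_star (p q : Idx n) : rootMat (star q) (star p) = -rootMat p q := by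
  apply Subtype.ext
  ext a b
  simp only [NegMemClass.coe_neg, Matrix.neg_apply, rootMat_apply, star_star, formWeight_star]
  ring

/-- The three inequalities kill every product of matrix units except the one through `q` and its
reflection through `star q`. -/
lemma rootMat_lie {p q r : Idx n} (hqr : q ≠ star r) (hqp : q ≠ star p) (hpr : p ≠ r) :
    ⁅rootMat p q, rootMat q r⁆ = formWeight q • rootMat p r := by
  apply Subtype.ext
  rw [LieSubalgebra.coe_bracket, Ring.lie_def]
  have h1 : r ≠ star q := fun h => hqr (by rw [h, star_star])
  have h2 : star p ≠ star r := star_injective.ne hpr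
  simp only [rootMat, sub_mul, mul_sub, Matrix.single_mul_single_same, SetLike.val_smul,
    Matrix.single_mul_single_of_ne _ _ _ _ hqr, Matrix.single_mul_single_of_ne _ _ _ _ hqp.symm,
    Matrix.single_mul_single_of_ne _ _ _ _ h2, Matrix.single_mul_single_of_ne _ _ _ _ hpr.symm,
    Matrix.single_mul_single_of_ne _ _ _ _ h1,
    Matrix.single_mul_single_of_ne _ _ _ _ (show star q ≠ p from fun h => hqp (by rw [← h, star_star])),
    smul_sub, Matrix.smul_single, smul_eq_mul]
  simp only [mul_comm (formWeight q)]
  abel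

/-- This supplies a case `p = r` excluded from `rootMat_lie`. It is the way to reach diagonal
matrices from root vectors. -/
lemma rootMat_lie_middle {p : Idx n} (hp : p ≠ Sum.inl ()) :
    ⁅rootMat p (Sum.inl ()), rootMat (Sum.inl ()) p⁆ = (2 : ℂ) • rootMat p p := by
  apply Subtype.ext
  rw [LieSubalgebra.coe_bracket, Ring.lie_def]
  have h0 : star (Sum.inl () : Idx n) = Sum.inl () := rfl
  have hs : star p ≠ Sum.inl () := fun h => hp (by rw [star_eq_iff.mp h, h0])
  have hp' : p ≠ star p := by rcases p with _ | _ | _ <;> simp_all [star]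
  simp only [rootMat, sub_mul, mul_sub, Matrix.single_mul_single_same, SetLike.val_smul, h0,
    Matrix.single_mul_single_of_ne _ _ _ _ hs, Matrix.single_mul_single_of_ne _ _ _ _ hs.symm,
    Matrix.single_mul_single_of_ne _ _ _ _ hp, Matrix.single_mul_single_of_ne _ _ _ _ hp.symm,
    smul_sub, Matrix.smul_single, smul_eq_mul]
  have h2 : formWeight (Sum.inl () : Idx n) = 2 := rfl
  simp only [h2, mul_comm]
  abel

/-- Every element is a combination of root vectors. -/
lemma eq_sum_rootMat (A : SoB n) :
    A = (2 : ℂ)⁻¹ • ∑ p, ∑ q, (A.1 p q / formWeight q) • rootMat p q := by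
  apply Subtype.ext
  ext a b
  have h1 : ∀ f : Idx n → Idx n → ℂ, (∑ p, ∑ q, if p = a ∧ q = b then f p q else 0) = f a b := by
    intro f
    simp only [ite_and]
    rw [Finset.sum_eq_single a (by intro p _ hp; simp [hp]) (by simp)]
    simp
  have h2 : ∀ f : Idx n → Idx n → ℂ,
      (∑ p, ∑ q, if star q = a ∧ star p = b then f p q else 0) = f (star b) (star a) := by
    intro f
    have : ∀ p q : Idx n, (star q = a ∧ star p = b) ↔ (p = star b ∧ q = star a) := by
      intro p q
      rw [star_eq_iff, star_eq_iff, and_comm]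
    simp only [this, ite_and]
    rw [Finset.sum_eq_single (star b) (by intro p _ hp; simp [hp]) (by simp)]
    simp
  -- The `(a, b)` entry of the sum receives one contribution from `(p, q) = (a, b)` and one from the
  -- reflected position. They agree by this relation, which explains the factor `2⁻¹`.
  have h3 := entry_star A a b
  have ha := formWeight_ne_zero a
  have hb := formWeight_ne_zero b
  simp only [SetLike.val_smul, Matrix.smul_apply, AddSubmonoidClass.coe_finsetSum,
    Matrix.sum_apply, rootMat_apply, smul_eq_mul, mul_sub, mul_ite, mul_zero,
    Finset.sum_sub_distrib, h1, h2, formWeight_star]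
  field_simp
  linear_combination h3

/-! ### Weights of matrix entries -/

/-- The coordinates of the weight `e_p`. -/
def wt (i : Fin n) : Idx n → ℤ
  | Sum.inl _ => 0
  | Sum.inr (Sum.inl j) => if j = i then 1 else 0
  | Sum.inr (Sum.inr j) => if j = i then -1 else 0

lemma wt_star (i : Fin n) (p : Idx n) : wt i (star p) = -wt i p := by
  rcases p with _ | j | j <;> simp only [wt, star] <;> (try split_ifs) <;> norm_num

/-- A sum of two vectors among `0` and `±e_i` determines the two summands up to order unless it is
zero. Only coordinates indexed by the four given elements matter, which leaves a finite case check.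
-/
lemma eq_or_of_wt_add {a b a' b' : Idx n} (h : ∀ i, wt i a + wt i b = wt i a' + wt i b') :
    (b = star a ∧ b' = star a') ∨ (a' = a ∧ b' = b) ∨ (a' = b ∧ b' = a) := by
  rcases a with _ | a | a <;> rcases b with _ | b | b <;> rcases a' with _ | a' | a' <;>
    rcases b' with _ | b' | b' <;> simp only [wt, star] at h ⊢ <;> (try have h1 := h a) <;>
    (try have h2 := h b) <;> (try have h3 := h a') <;> (try have h4 := h b') <;> clear h <;> grind

/-- Two entries with the same weight are both diagonal, or equal, or exchanged by the symmetry of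
the matrices in the Lie algebra. -/
lemma eq_or_of_wt_sub {p q p' q' : Idx n} (h : ∀ i, wt i p - wt i q = wt i p' - wt i q') :
    (p = q ∧ p' = q') ∨ (p' = p ∧ q' = q) ∨ (p' = star q ∧ q' = star p) := by
  have := eq_or_of_wt_add (a := p) (b := star q) (a' := p') (b' := star q')
    (fun i => by rw [wt_star, wt_star]; linarith [h i])
  rcases this with ⟨h1, h2⟩ | ⟨h1, h2⟩ | ⟨h1, h2⟩
  · exact Or.inl ⟨(star_injective h1).symm, (star_injective h2).symm⟩
  · exact Or.inr (Or.inl ⟨h1, star_injective h2⟩)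
  · exact Or.inr (Or.inr ⟨h1, by rw [← h2, star_star]⟩)

lemma rootMat_diag_apply (i : Fin n) (p q : Idx n) :
    (rootMat (Sum.inr (Sum.inl i)) (Sum.inr (Sum.inl i))).1 p q =
      if p = q then (wt i p : ℂ) else 0 := by
  rw [rootMat_apply]
  rcases p with _ | j | j <;> rcases q with _ | k | k <;> simp [star, wt, formWeight] <;> grind

lemma rootMat_self_mem_finCartan (p : Idx n) : rootMat p p ∈ finCartan n := by
  intro a b hab
  refine rootMat_apply_of_ne ?_ ?_ <;> rintro ⟨h, h'⟩ <;> exact hab (h.symm.trans h')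

lemma cartan_lie_apply {H : SoB n} (hH : H ∈ finCartan n) (A : SoB n) (p q : Idx n) :
    (⁅H, A⁆ : SoB n).1 p q = (H.1 p p - H.1 q q) * A.1 p q := by
  rw [coe_lie_apply, Finset.sum_eq_single p, Finset.sum_eq_single q]
  · ring
  · intro r _ hr; simp [hH r q hr]
  · simp
  · intro r _ hr; simp [hH p r hr.symm]
  · simp

end TypeB
end

/-! ### Entries, weights and root spaces -/

noncomputable section

namespace TypeB

open UntwistedAffine

variable {n : ℕ}

/-- The `(p, q)` entry of the coefficient at `t ^ k`. -/
def entry (k : ℤ) (p q : Idx n) : AffineB n →ₗ[ℂ] ℂ where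
  toFun x := (coeff k x).1 p q
  map_add' x y := by simp
  map_smul' a x := by simp

lemma entry_eq (k : ℤ) (p q : Idx n) (x : AffineB n) : entry k p q x = (coeff k x).1 p q := rfl

lemma coeff_eq_zero_of_entry {k : ℤ} {x : AffineB n} (h : ∀ p q, entry k p q x = 0) :
    coeff k x = 0 := by
  apply Subtype.ext
  ext p q
  exact h p q

lemma ext_entry {x y : AffineB n} (h : ∀ k p q, entry k p q x = entry k p q y)
    (hc : x.central = y.central) (hd : x.deg = y.deg) : x = y :=
  ext_coeff (fun k => Subtype.ext (Matrix.ext fun p q => h k p q)) hc hd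

lemma d_mem_affineCartan : d ∈ affineCartan n := Submodule.subset_span (Or.inl (Or.inr rfl))

lemma monomial_mem_affineCartan {H : SoB n} (h : H ∈ finCartan n) :
    monomial 0 H ∈ affineCartan n := Submodule.subset_span (Or.inr ⟨H, h, rfl⟩)

lemma coeff_of_mem_affineCartan {x : AffineB n} (hx : x ∈ affineCartan n) :
    (∀ k ≠ 0, coeff k x = 0) ∧ coeff 0 x ∈ finCartan n := by
  rw [affineCartan] at hx
  induction hx using Submodule.span_induction with
  | zero => exact ⟨fun k _ => map_zero _, by rw [map_zero]; exact zero_mem _⟩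
  | add x y _ _ hx hy =>
    refine ⟨fun k hk => by rw [map_add, hx.1 k hk, hy.1 k hk, add_zero], ?_⟩
    rw [map_add]
    exact add_mem hx.2 hy.2
  | smul a x _ hx =>
    refine ⟨fun k hk => by rw [map_smul, hx.1 k hk, smul_zero], ?_⟩
    rw [map_smul]
    exact Submodule.smul_mem _ _ hx.2
  | mem x hx =>
    rcases hx with (rfl | rfl) | ⟨H, hH, rfl⟩
    · exact ⟨fun k _ => coeff_c k, by rw [coeff_c]; exact zero_mem _⟩
    · exact ⟨fun k _ => coeff_d k, by rw [coeff_d]; exact zero_mem _⟩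
    · refine ⟨fun k hk => by rw [coeff_monomial, if_neg hk.symm], ?_⟩
      rw [coeff_monomial, if_pos rfl]
      exact hH

lemma mem_affineNilPlus_iff {x : AffineB n} :
    x ∈ affineNilPlus n ↔ x.central = 0 ∧ x.deg = 0 ∧ (∀ k < 0, coeff k x = 0) ∧
      coeff 0 x ∈ finNilPlus n := by
  constructor
  · intro hx
    rw [affineNilPlus] at hx
    induction hx using Submodule.span_induction with
    | zero => exact ⟨rfl, rfl, fun k _ => map_zero _, by rw [map_zero]; exact zero_mem _⟩
    | add x y _ _ hx hy =>
      refine ⟨?_, ?_, fun k hk => by rw [map_add, hx.2.2.1 k hk, hy.2.2.1 k hk, add_zero], ?_⟩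
      · rw [add_eq_mk]; simp [hx.1, hy.1]
      · rw [add_eq_mk]; simp [hx.2.1, hy.2.1]
      · rw [map_add]; exact add_mem hx.2.2.2 hy.2.2.2
    | smul a x _ hx =>
      refine ⟨?_, ?_, fun k hk => by rw [map_smul, hx.2.2.1 k hk, smul_zero], ?_⟩
      · rw [smul_eq_mk]; simp [hx.1]
      · rw [smul_eq_mk]; simp [hx.2.1]
      · rw [map_smul]; exact Submodule.smul_mem _ _ hx.2.2.2
    | mem x hx =>
      rcases hx with ⟨A, hA, rfl⟩ | ⟨k, A, hk, rfl⟩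
      · refine ⟨rfl, rfl, fun k hk => by rw [coeff_monomial, if_neg hk.ne'], ?_⟩
        rw [coeff_monomial, if_pos rfl]
        exact hA
      · refine ⟨rfl, rfl, fun m hm => by rw [coeff_monomial, if_neg (by lia)], ?_⟩
        rw [coeff_monomial, if_neg hk.ne']
        exact zero_mem _
  · rintro ⟨hc, hd, hneg, h0⟩
    obtain ⟨s, hs⟩ := exists_finset_coeff_eq_zero x
    rw [eq_sum_monomial hc hd hs]
    refine Submodule.sum_mem _ fun k _ => ?_
    rcases lt_trichotomy k 0 with hk | rfl | hk
    · rw [hneg k hk, monomial_zero]; exact zero_mem _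
    · exact Submodule.subset_span (Or.inl ⟨_, h0, rfl⟩)
    · exact Submodule.subset_span (Or.inr ⟨k, _, hk, rfl⟩)

lemma affineCartan_le_affineBorel : affineCartan n ≤ (affineBorel n).toSubmodule := le_sup_left

lemma affineNilPlus_le_affineBorel : affineNilPlus n ≤ (affineBorel n).toSubmodule := le_sup_right

lemma coeff_of_mem_affineBorel {x : AffineB n} (hx : x ∈ affineBorel n) :
    (∀ k < 0, coeff k x = 0) ∧ ∀ p q, basisPos q < basisPos p → entry 0 p q x = 0 := by
  obtain ⟨h, hh, y, hy, rfl⟩ := Submodule.mem_sup.mp (show x ∈ affineCartan n ⊔ affineNilPlus n from hx)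
  have h1 := coeff_of_mem_affineCartan hh
  have h2 := mem_affineNilPlus_iff.mp hy
  refine ⟨fun k hk => ?_, fun p q hpq => ?_⟩
  · rw [map_add, h1.1 k hk.ne, h2.2.2.1 k hk, add_zero]
  · rw [map_add, entry_eq, entry_eq, h1.2 p q (by rintro rfl; exact lt_irrefl _ hpq),
      h2.2.2.2 p q hpq.le, add_zero]

/-- The weight of the basis vector `u_p`. -/
def idxWeight : Idx n → Module.Dual ℂ (affineCartan n)
  | Sum.inl _ => 0
  | Sum.inr (Sum.inl i) => eps n i
  | Sum.inr (Sum.inr i) => -eps n i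

/-- The weight of the `(p, q)` entry at `t ^ k`. -/
def rootFun (k : ℤ) (p q : Idx n) : Module.Dual ℂ (affineCartan n) :=
  (k : ℂ) • delta n + (idxWeight p - idxWeight q)

lemma idxWeight_star (p : Idx n) : idxWeight (star p) = -idxWeight p := by
  rcases p with _ | i | i <;> simp [star, idxWeight]

lemma rootFun_star (k : ℤ) (p q : Idx n) : rootFun k (star q) (star p) = rootFun k p q := by
  rw [rootFun, rootFun, idxWeight_star, idxWeight_star]
  abel

lemma rootFun_self (k : ℤ) (p : Idx n) : rootFun k p p = (k : ℂ) • delta n := by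
  rw [rootFun, sub_self, add_zero]

lemma idxWeight_apply (h : affineCartan n) (p : Idx n) :
    idxWeight p h = (coeff 0 (h : AffineB n)).1 p p := by
  rcases p with _ | i | i
  · exact (entry_antidiag _ (Sum.inl ())).symm
  · rfl
  · have := entry_star (coeff 0 (h : AffineB n)) (Sum.inr (Sum.inl i)) (Sum.inr (Sum.inl i))
    simp only [formWeight, star, one_mul] at this
    rw [this]
    rfl

lemma entry_cartan_lie (h : affineCartan n) (x : AffineB n) (k : ℤ) (p q : Idx n) :
    entry k p q ⁅(h : AffineB n), x⁆ = rootFun k p q h * entry k p q x := by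
  obtain ⟨h1, h2⟩ := coeff_of_mem_affineCartan h.2
  have h3 : (x.deg * k) • coeff k (h : AffineB n) = 0 := by
    by_cases hk : k = 0
    · simp [hk]
    · rw [h1 k hk, smul_zero]
  have key := coeff_lie (h : AffineB n) x k {0} (fun m hm => by
    rw [h1 m (by simpa using hm), zero_lie])
  rw [Finset.sum_singleton, h3, sub_zero, sub_zero] at key
  rw [entry_eq, key]
  change (⁅coeff 0 (h : AffineB n), coeff k x⁆ : SoB n).1 p q +
    (((h : AffineB n).deg * k) • coeff k x).1 p q = _
  rw [cartan_lie_apply h2, ← idxWeight_apply, ← idxWeight_apply]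
  simp only [rootFun, LinearMap.add_apply, LinearMap.smul_apply, LinearMap.sub_apply, entry_eq,
    smul_eq_mul, SetLike.val_smul, Matrix.smul_apply]
  have : delta n h = (h : AffineB n).deg := rfl
  rw [this]
  ring

lemma central_cartan_lie (h : affineCartan n) (x : AffineB n) :
    (⁅(h : AffineB n), x⁆ : AffineB n).central = 0 :=
  central_lie_eq_zero fun m hm => Or.inl ((coeff_of_mem_affineCartan h.2).1 m hm)

/-- The derivation `d` as an element of the Cartan subalgebra. -/
def cartanD (n : ℕ) : affineCartan n := ⟨d, d_mem_affineCartan⟩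

/-- The element of the Cartan subalgebra dual to `e_i`. -/
def cartanH (i : Fin n) : affineCartan n :=
  ⟨monomial 0 (rootMat (Sum.inr (Sum.inl i)) (Sum.inr (Sum.inl i))),
    monomial_mem_affineCartan (rootMat_self_mem_finCartan _)⟩

lemma rootFun_cartanD (k : ℤ) (p q : Idx n) : rootFun k p q (cartanD n) = k := by
  have h1 : ∀ p : Idx n, idxWeight p (cartanD n) = 0 := by
    intro p
    rw [idxWeight_apply, cartanD, coeff_d]
    rfl
  have h2 : delta n (cartanD n) = 1 := rfl
  simp [rootFun, h1, h2]

lemma rootFun_cartanH (k : ℤ) (p q : Idx n) (i : Fin n) :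
    rootFun k p q (cartanH i) = ((wt i p - wt i q : ℤ) : ℂ) := by
  have h1 : ∀ p : Idx n, idxWeight p (cartanH i) = wt i p := by
    intro p
    rw [idxWeight_apply, cartanH, coeff_monomial, if_pos rfl, rootMat_diag_apply, if_pos rfl]
  have h2 : delta n (cartanH i) = 0 := rfl
  simp [rootFun, h1, h2]

/-- Evaluation at `d` recovers the degree, and evaluation at the elements `cartanH i` recovers the
coordinates of the finite part. Apart from multiples of `δ`, a weight therefore fixes the position
up to reflection. -/
lemma eq_or_of_rootFun_eq {k k' : ℤ} {p q p' q' : Idx n} (h : rootFun k p q = rootFun k' p' q') :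
    k = k' ∧ ((p = q ∧ p' = q') ∨ (p' = p ∧ q' = q) ∨ (p' = star q ∧ q' = star p)) := by
  refine ⟨?_, eq_or_of_wt_sub fun i => ?_⟩
  · have := LinearMap.congr_fun h (cartanD n)
    rw [rootFun_cartanD, rootFun_cartanD] at this
    exact_mod_cast this
  · have := LinearMap.congr_fun h (cartanH i)
    rw [rootFun_cartanH, rootFun_cartanH] at this
    exact_mod_cast this

lemma eq_rootFun_of_entry_ne_zero {α : Module.Dual ℂ (affineCartan n)} {x : AffineB n}
    (hx : x ∈ affineRootSpace n α) {k : ℤ} {p q : Idx n} (h : entry k p q x ≠ 0) :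
    α = rootFun k p q := by
  ext1 t
  have h1 := entry_cartan_lie t x k p q
  rw [show ⁅(t : AffineB n), x⁆ = α t • x from hx t, map_smul, smul_eq_mul] at h1
  exact mul_right_cancel₀ h h1

lemma central_deg_of_mem_rootSpace {α : Module.Dual ℂ (affineCartan n)} (hα : α ≠ 0) {x : AffineB n}
    (hx : x ∈ affineRootSpace n α) : x.central = 0 ∧ x.deg = 0 := by
  obtain ⟨t, ht⟩ : ∃ t, α t ≠ 0 := by
    by_contra! h
    exact hα (LinearMap.ext h)
  have h1 : ⁅(t : AffineB n), x⁆ = α t • x := hx t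
  have h2 := central_cartan_lie t x
  have h3 := deg_lie (t : AffineB n) x
  rw [h1, smul_eq_mk] at h2 h3
  simp only [smul_eq_mul, mul_eq_zero, ht, false_or] at h2 h3
  exact ⟨h2, h3⟩

/-- The root vector `(w_q E_{p,q} - w_p E_{-q,-p}) ⊗ t ^ k`. -/
def rootVec (k : ℤ) (p q : Idx n) : AffineB n := monomial k (rootMat p q)

lemma rootVec_star (k : ℤ) (p q : Idx n) : rootVec k (star q) (star p) = -rootVec k p q := by
  rw [rootVec, rootMat_star, rootVec, ← neg_one_smul ℂ, monomial_smul, neg_one_smul]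

lemma entry_rootVec (k m : ℤ) (p q a b : Idx n) :
    entry m a b (rootVec k p q) = if k = m then (rootMat p q).1 a b else 0 := by
  rw [entry_eq, rootVec, coeff_monomial]
  split_ifs <;> rfl

lemma entry_rootVec_self (k : ℤ) {p q : Idx n} (h : q ≠ star p) :
    entry k p q (rootVec k p q) ≠ 0 := by
  rw [entry_rootVec, if_pos rfl, rootMat_apply_self h]
  exact formWeight_ne_zero q

lemma eq_or_of_entry_rootVec_ne_zero {k m : ℤ} {p q a b : Idx n}
    (h : entry m a b (rootVec k p q) ≠ 0) :
    m = k ∧ ((a = p ∧ b = q) ∨ (a = star q ∧ b = star p)) := by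
  rw [entry_rootVec] at h
  split_ifs at h with hk
  · refine ⟨hk.symm, ?_⟩
    by_contra hc
    push Not at hc
    refine h (rootMat_apply_of_ne ?_ ?_)
    · rintro ⟨rfl, rfl⟩; exact hc.1 rfl rfl
    · rintro ⟨rfl, rfl⟩; exact hc.2 rfl rfl
  · exact absurd rfl h

lemma rootVec_mem_rootSpace (k : ℤ) (p q : Idx n) :
    rootVec k p q ∈ affineRootSpace n (rootFun k p q) := by
  intro t
  refine ext_entry (fun m a b => ?_) ?_ ?_
  · rw [entry_cartan_lie, map_smul, smul_eq_mul]
    by_cases h : entry m a b (rootVec k p q) = 0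
    · rw [h, mul_zero, mul_zero]
    · obtain ⟨rfl, ⟨rfl, rfl⟩ | ⟨rfl, rfl⟩⟩ := eq_or_of_entry_rootVec_ne_zero h
      · rfl
      · rw [rootFun_star]
  · rw [central_cartan_lie, smul_eq_mk]
    simp [rootVec, monomial]
  · rw [deg_lie, smul_eq_mk]
    simp [rootVec, monomial]

/-- The condition `hkm` removes the central term. -/
lemma rootVec_lie (k m : ℤ) (hkm : k + m ≠ 0 ∨ k = 0) {p q r : Idx n} (hqr : q ≠ star r)
    (hqp : q ≠ star p) (hpr : p ≠ r) :
    ⁅rootVec k p q, rootVec m q r⁆ = formWeight q • rootVec (k + m) p r := by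
  rw [rootVec, rootVec, monomial_lie_monomial, rootMat_lie hqr hqp hpr, monomial_smul]
  rcases hkm with h | rfl
  · rw [if_neg h, zero_smul, add_zero]; rfl
  · simp [rootVec]

lemma rootVec_mem_affineNilPlus {k : ℤ} {p q : Idx n}
    (h : 0 < k ∨ (k = 0 ∧ basisPos p < basisPos q)) : rootVec k p q ∈ affineNilPlus n := by
  rcases h with h | ⟨rfl, h⟩
  · exact Submodule.subset_span (Or.inr ⟨k, _, h, rfl⟩)
  · refine Submodule.subset_span (Or.inl ⟨_, fun a b hab => rootMat_apply_of_ne ?_ ?_, rfl⟩)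
    · rintro ⟨rfl, rfl⟩; lia
    · rintro ⟨rfl, rfl⟩
      rw [basisPos_star, basisPos_star] at hab
      have := basisPos_le q
      lia

lemma exists_rootFun_of_mem_finPosRoots {γ : Module.Dual ℂ (affineCartan n)}
    (h : γ ∈ finPosRoots n) : ∃ p q : Idx n, γ = rootFun 0 p q ∧ basisPos p < basisPos q ∧
      q ≠ star p ∧ p ≠ star p := by
  rcases h with ⟨i, rfl⟩ | ⟨i, j, hij, rfl | rfl⟩
  · refine ⟨Sum.inr (Sum.inl i), Sum.inl (), ?_, ?_, ?_, ?_⟩ <;>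
      simp [rootFun, idxWeight, basisPos, star]
  · refine ⟨Sum.inr (Sum.inl i), Sum.inr (Sum.inl j), ?_, ?_, ?_, ?_⟩ <;>
      simp [rootFun, idxWeight, basisPos, star, hij]
  · refine ⟨Sum.inr (Sum.inl i), Sum.inr (Sum.inr j), ?_, ?_, ?_, ?_⟩
    · simp [rootFun, idxWeight]
    · simp only [basisPos]; lia
    · simp [star, hij.ne']
    · simp [star]

lemma delta_eq_rootFun (p : Idx n) : delta n = rootFun 1 p p := by
  rw [rootFun_self, Int.cast_one, one_smul]

lemma delta_ne_zero : delta n ≠ 0 := fun h => by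
  have : delta n (cartanD n) = 1 := rfl
  rw [h] at this
  simp at this

lemma entry_of_mem_rootSpace_delta {x : AffineB n} (hx : x ∈ affineRootSpace n (delta n)) {k : ℤ}
    {p q : Idx n} (h : entry k p q x ≠ 0) : k = 1 ∧ p = q := by
  have h1 := eq_rootFun_of_entry_ne_zero hx h
  rw [delta_eq_rootFun (Sum.inl ())] at h1
  obtain ⟨h2, ⟨-, h3⟩ | ⟨rfl, rfl⟩ | ⟨rfl, rfl⟩⟩ := eq_or_of_rootFun_eq h1
  · exact ⟨h2.symm, h3⟩
  · exact ⟨h2.symm, rfl⟩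
  · exact ⟨h2.symm, rfl⟩

lemma isPosRoot_delta (hn : 0 < n) : IsPosRoot n (delta n) := by
  refine ⟨delta_ne_zero, ?_, fun x hx => ?_⟩
  · have h1 := rootVec_mem_rootSpace 1 (Sum.inr (Sum.inl ⟨0, hn⟩) : Idx n) (Sum.inr (Sum.inl ⟨0, hn⟩))
    rw [← delta_eq_rootFun] at h1
    intro h
    rw [h, Submodule.mem_bot] at h1
    have h2 := entry_rootVec_self 1 (p := (Sum.inr (Sum.inl ⟨0, hn⟩) : Idx n))
      (q := Sum.inr (Sum.inl ⟨0, hn⟩)) (by simp [star])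
    rw [h1, map_zero] at h2
    exact h2 rfl
  · obtain ⟨hc, hd⟩ := central_deg_of_mem_rootSpace delta_ne_zero hx
    refine mem_affineNilPlus_iff.mpr ⟨hc, hd, fun k hk => coeff_eq_zero_of_entry fun p q => ?_,
      fun p q _ => ?_⟩
    · by_contra h
      have := (entry_of_mem_rootSpace_delta hx h).1
      lia
    · by_contra h
      have := (entry_of_mem_rootSpace_delta (k := 0) hx h).1
      lia

end TypeB
end

/-! ### The ideal of a commuting pair of upper sets -/

noncomputable section

namespace TypeB

open UntwistedAffine

/-- The positive roots of `B_n`, as positions `(i, q)` of matrix entries above the diagonal and to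
the left of the antidiagonal. -/
def rootTri (n : ℕ) : Set (ℕ × ℕ) := {x | x.1 < x.2 ∧ x.1 + x.2 < 2 * n}

/-- Upper sets of the poset of positive roots. -/
structure IsUpper (n : ℕ) (A : Set (ℕ × ℕ)) : Prop where
  subset : A ⊆ rootTri n
  mem_of_le : ∀ {i q j r : ℕ}, (i, q) ∈ A → (j, r) ∈ rootTri n → j ≤ i → q ≤ r → (j, r) ∈ A

/-- Pairs of upper sets such that no root of the first and root of the second add up to the highest
root. -/
structure IsCommutingPair (n : ℕ) (A C : Set (ℕ × ℕ)) : Prop where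
  left : IsUpper n A
  right : IsUpper n C
  not_left : ∀ p, 2 ≤ p → p ≤ 2 * n - 2 → (0, 2 * n - p) ∈ A → (1, p) ∉ C
  not_right : ∀ p, 2 ≤ p → p ≤ 2 * n - 2 → (0, 2 * n - p) ∈ C → (1, p) ∉ A

lemma IsCommutingPair.symm {n : ℕ} {A C : Set (ℕ × ℕ)} (h : IsCommutingPair n A C) :
    IsCommutingPair n C A := ⟨h.right, h.left, h.not_right, h.not_left⟩

/-- The set of positions of matrix entries obtained by reflection in the antidiagonal. -/
def Full (n : ℕ) (A : Set (ℕ × ℕ)) (p q : ℕ) : Prop :=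
  (p + q < 2 * n ∧ (p, q) ∈ A) ∨ (2 * n < p + q ∧ (2 * n - q, 2 * n - p) ∈ A)

section Full

variable {n : ℕ} {A C : Set (ℕ × ℕ)}

lemma Full.add_ne {p q : ℕ} (h : Full n A p q) : p + q ≠ 2 * n := by
  rcases h with h | h <;> lia

lemma IsUpper.lt_of_full (hA : IsUpper n A) {p q : ℕ} (h : Full n A p q) : p < q := by
  rcases h with ⟨_, h⟩ | ⟨_, h⟩
  · exact (hA.subset h).1
  · have := (hA.subset h).1
    simp only at this
    lia

lemma full_reflect {p q : ℕ} (hp : p ≤ 2 * n) (hq : q ≤ 2 * n) :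
    Full n A (2 * n - q) (2 * n - p) ↔ Full n A p q := by
  have h1 : 2 * n - (2 * n - p) = p := by lia
  have h2 : 2 * n - (2 * n - q) = q := by lia
  unfold Full
  rw [h1, h2, or_comm]
  refine or_congr (and_congr_left fun _ => ?_) (and_congr_left fun _ => ?_) <;> lia

/-- Reflection in the antidiagonal preserves the order "up and to the right". A position may
therefore move in these directions even across the antidiagonal, provided it does not end on it. -/
lemma IsUpper.full_mono (hA : IsUpper n A) {p q p' q' : ℕ} (h : Full n A p q) (hp : p' ≤ p)
    (hq : q ≤ q') (hq' : q' ≤ 2 * n) (hne : p' + q' ≠ 2 * n) : Full n A p' q' := by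
  have hpq := hA.lt_of_full h
  rcases lt_or_gt_of_ne hne with hlt | hgt
  · refine Or.inl ⟨hlt, ?_⟩
    rcases h with ⟨_, h⟩ | ⟨_, h⟩
    · exact hA.mem_of_le h ⟨by simp only; lia, hlt⟩ hp hq
    · exact hA.mem_of_le h ⟨by simp only; lia, hlt⟩ (by lia) (by lia)
  · refine Or.inr ⟨hgt, ?_⟩
    have ht : (2 * n - q', 2 * n - p') ∈ rootTri n := ⟨by simp only; lia, by simp only; lia⟩
    rcases h with ⟨_, h⟩ | ⟨_, h⟩
    · exact hA.mem_of_le h ht (by lia) (by lia)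
    · exact hA.mem_of_le h ht (by lia) (by lia)

/-- The roots of the two members of a commuting pair never add up to a root. -/
lemma IsCommutingPair.not_full (h : IsCommutingPair n A C) {r q p : ℕ} (hp : p ≤ 2 * n)
    (hrp : r + p ≠ 2 * n) (hA : Full n A r q) : ¬ Full n C q p := by
  intro hC
  have hrq := h.left.lt_of_full hA
  have hqp := h.right.lt_of_full hC
  -- Positions `(0, 2n - p)` and `(1, p)` are roots whose sum is the highest root. In each case
  -- below, the given positions or their reflections are raised to such a pair; which of the two
  -- sets supplies row 0 depends on the sides of the antidiagonal.
  have key : ∀ p, 2 ≤ p → p ≤ 2 * n - 2 → Full n A 0 (2 * n - p) → Full n C 1 p → False := by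
    rintro p h2 hp (⟨_, h0⟩ | ⟨_, h0⟩) (⟨_, h1⟩ | ⟨_, h1⟩)
    · exact h.not_left p h2 hp h0 h1
    all_goals lia
  have key' : ∀ p, 2 ≤ p → p ≤ 2 * n - 2 → Full n C 0 (2 * n - p) → Full n A 1 p → False := by
    rintro p h2 hp (⟨_, h0⟩ | ⟨_, h0⟩) (⟨_, h1⟩ | ⟨_, h1⟩)
    · exact h.not_right p h2 hp h0 h1
    all_goals lia
  have hA' := (full_reflect (A := A) (p := r) (q := q) (by lia) (by lia)).mpr hA
  have hC' := (full_reflect (A := C) (p := q) (q := p) (by lia) (by lia)).mpr hC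
  have hne := hA.add_ne
  have hne' := hC.add_ne
  rcases lt_or_ge (q + p) (2 * n) with h1 | h1
  · exact key p (by lia) (by lia) (h.left.full_mono hA (by lia) (by lia) (by lia) (by lia))
      (h.right.full_mono hC (by lia) le_rfl (by lia) (by lia))
  rcases lt_or_ge (r + q) (2 * n) with h2 | h2
  · rcases lt_or_gt_of_ne hrp with h3 | h3
    · exact key (2 * n - q) (by lia) (by lia)
        (h.left.full_mono hA (by lia) (by lia) (by lia) (by lia))
        (h.right.full_mono hC' (by lia) le_rfl (by lia) (by lia))
    · exact key' q (by lia) (by lia)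
        (h.right.full_mono hC' (by lia) (by lia) (by lia) (by lia))
        (h.left.full_mono hA (by lia) le_rfl (by lia) (by lia))
  · exact key' (2 * n - r) (by lia) (by lia)
      (h.right.full_mono hC' (by lia) (by lia) (by lia) (by lia))
      (h.left.full_mono hA' (by lia) le_rfl (by lia) (by lia))

end Full

variable {n : ℕ} {A C : Set (ℕ × ℕ)}

/-- The entries that may be nonzero in the ideal attached to a commuting pair. -/
def Allowed (A C : Set (ℕ × ℕ)) (k : ℤ) (p q : Idx n) : Prop :=
  2 ≤ k ∨ (k = 1 ∧ ¬ Full n C (basisPos q) (basisPos p)) ∨ (k = 0 ∧ Full n A (basisPos p) (basisPos q))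

lemma allowed_star (k : ℤ) (p q : Idx n) :
    Allowed A C k (star q) (star p) ↔ Allowed A C k p q := by
  unfold Allowed
  rw [basisPos_star, basisPos_star, full_reflect (basisPos_le _) (basisPos_le _),
    full_reflect (basisPos_le _) (basisPos_le _)]

lemma IsCommutingPair.allowed_one_of_le (h : IsCommutingPair n A C) {p q : Idx n}
    (hpq : basisPos p ≤ basisPos q) : Allowed A C 1 p q :=
  Or.inr (Or.inl ⟨rfl, fun hf => absurd (h.right.lt_of_full hf) (by lia)⟩)

/-! ### From a commuting pair to a basic ideal -/

/-- The elements of `𝔫̃₊` whose nonzero entries are allowed. -/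
def idealSpace (n : ℕ) (A C : Set (ℕ × ℕ)) : Submodule ℂ (AffineB n) where
  carrier := {x | x ∈ affineNilPlus n ∧ ∀ k p q, ¬ Allowed A C k p q → entry k p q x = 0}
  add_mem' hx hy := ⟨add_mem hx.1 hy.1, fun k p q h => by
    rw [map_add, hx.2 k p q h, hy.2 k p q h, add_zero]⟩
  zero_mem' := ⟨zero_mem _, fun k p q _ => map_zero _⟩
  smul_mem' a x hx := ⟨Submodule.smul_mem _ _ hx.1, fun k p q h => by
    rw [map_smul, hx.2 k p q h, smul_zero]⟩

lemma mem_idealSpace {x : AffineB n} : x ∈ idealSpace n A C ↔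
    x ∈ affineNilPlus n ∧ ∀ k p q, entry k p q x ≠ 0 → Allowed A C k p q :=
  and_congr_right fun _ => forall_congr' fun _ => forall_congr' fun _ => forall_congr' fun _ =>
    not_imp_comm

lemma entry_ne_star {k : ℤ} {p q : Idx n} {x : AffineB n} (h : entry k p q x ≠ 0) :
    basisPos p + basisPos q ≠ 2 * n := fun hs => by
  rw [← eq_star_iff] at hs
  exact h (by rw [entry_eq, hs, entry_antidiag])

lemma lie_apply_eq_zero {X Y : SoB n} {p q : Idx n} (h1 : ∀ r, X.1 p r ≠ 0 → Y.1 r q ≠ 0 → False)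
    (h2 : ∀ r, Y.1 p r ≠ 0 → X.1 r q ≠ 0 → False) : (⁅X, Y⁆ : SoB n).1 p q = 0 := by
  rw [coe_lie_apply, Finset.sum_eq_zero, Finset.sum_eq_zero, sub_zero]
  · intro r _
    by_contra h
    exact h2 r (left_ne_zero_of_mul h) (right_ne_zero_of_mul h)
  · intro r _
    by_contra h
    exact h1 r (left_ne_zero_of_mul h) (right_ne_zero_of_mul h)

/-- Only degrees 0 and 1 need checking. Degree 0 uses that `A` is an upper set. In degree 1, the
bracket of `y` in degree 0 with `x` in degree 1 uses that `C` is an upper set, while the bracket of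
`y` in degree 1 with `x` in degree 0 uses that `A` and `C` commute. -/
lemma IsCommutingPair.lie_mem_idealSpace (h : IsCommutingPair n A C) {x y : AffineB n}
    (hy : y ∈ affineBorel n) (hx : x ∈ idealSpace n A C) : ⁅y, x⁆ ∈ idealSpace n A C := by
  obtain ⟨hx1, hx2⟩ := mem_idealSpace.mp hx
  obtain ⟨-, hxd, hxneg, hx0⟩ := mem_affineNilPlus_iff.mp hx1
  obtain ⟨hyneg, hy0⟩ := coeff_of_mem_affineBorel hy
  have hy0' : ∀ {p q}, (coeff 0 y).1 p q ≠ 0 → basisPos p ≤ basisPos q := fun {p q} hne => by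
    by_contra! hlt
    exact hne (hy0 p q hlt)
  have hxA : ∀ {p q}, (coeff 0 x).1 p q ≠ 0 → Full n A (basisPos p) (basisPos q) := by
    intro p q hne
    rcases hx2 0 p q hne with h | h | h
    · lia
    · lia
    · exact h.2
  have hxC : ∀ {p q}, (coeff 1 x).1 p q ≠ 0 → ¬ Full n C (basisPos q) (basisPos p) := by
    intro p q hne
    rcases hx2 1 p q hne with h | h | h
    · lia
    · exact h.2
    · lia
  have hneg : ∀ k < 0, coeff k ⁅y, x⁆ = 0 := by
    intro k hk
    rw [coeff_lie y x k ∅ (fun m _ => ?_), hxneg k hk, hxd]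
    · simp
    · rcases lt_or_ge m 0 with hm | hm
      · rw [hyneg m hm, zero_lie]
      · rw [hxneg (k - m) (by lia), lie_zero]
  have hzero : coeff 0 ⁅y, x⁆ = ⁅coeff 0 y, coeff 0 x⁆ := by
    rw [coeff_lie y x 0 {0} (fun m hm => ?_), hxd]
    · simp
    · rcases lt_or_gt_of_ne (show m ≠ 0 by simpa using hm) with hm | hm
      · rw [hyneg m hm, zero_lie]
      · rw [hxneg (0 - m) (by lia), lie_zero]
  have hone : coeff 1 ⁅y, x⁆ = ⁅coeff 0 y, coeff 1 x⁆ + ⁅coeff 1 y, coeff 0 x⁆ +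
      y.deg • coeff 1 x := by
    rw [coeff_lie y x 1 {0, 1} (fun m hm => ?_), hxd]
    · rw [Finset.sum_pair (by simp)]
      simp
    · simp only [Finset.mem_insert, Finset.mem_singleton, not_or] at hm
      rcases lt_or_gt_of_ne hm.1 with h | h
      · rw [hyneg m h, zero_lie]
      · rw [hxneg (1 - m) (by lia), lie_zero]
  have hentry0 : ∀ p q, ¬ Full n A (basisPos p) (basisPos q) →
      (coeff 0 ⁅y, x⁆).1 p q = 0 := by
    intro p q hf
    by_cases hs : q = star p
    · rw [hs, entry_antidiag]
    rw [eq_star_iff] at hs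
    rw [hzero]
    refine lie_apply_eq_zero (fun r h1 h2 => ?_) (fun r h1 h2 => ?_)
    · exact hf (h.left.full_mono (hxA h2) (hy0' h1) le_rfl (basisPos_le _) hs)
    · exact hf (h.left.full_mono (hxA h1) le_rfl (hy0' h2) (basisPos_le _) hs)
  refine ⟨mem_affineNilPlus_iff.mpr ⟨?_, deg_lie y x, hneg, fun p q hpq => ?_⟩, fun k p q hk => ?_⟩
  · refine central_lie_eq_zero fun m hm => ?_
    rcases lt_or_gt_of_ne hm with hm | hm
    · exact Or.inl (hyneg m hm)
    · exact Or.inr (hxneg (-m) (by lia))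
  · exact hentry0 p q fun hf => absurd (h.left.lt_of_full hf) (by lia)
  · rcases lt_or_ge k 0 with h0 | h0
    · rw [entry_eq, hneg k h0]; rfl
    rcases h0.eq_or_lt with rfl | h0
    · exact hentry0 p q fun hf => hk (Or.inr (Or.inr ⟨rfl, hf⟩))
    rcases (show 1 ≤ k by lia).eq_or_lt with rfl | h1
    · have hC : Full n C (basisPos q) (basisPos p) := by
        by_contra hC
        exact hk (Or.inr (Or.inl ⟨rfl, hC⟩))
      have hs := hC.add_ne
      have hx1 : (coeff 1 x).1 p q = 0 := by
        by_contra hne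
        exact hxC hne hC
      have e1 : (⁅coeff 0 y, coeff 1 x⁆ : SoB n).1 p q = 0 := by
        refine lie_apply_eq_zero (fun r h1 h2 => ?_) (fun r h1 h2 => ?_)
        · have := entry_ne_star (k := 1) (x := x) h2
          exact hxC h2 (h.right.full_mono hC le_rfl (hy0' h1) (basisPos_le _) (by lia))
        · have := entry_ne_star (k := 1) (x := x) h1
          exact hxC h1 (h.right.full_mono hC (hy0' h2) le_rfl (basisPos_le _) (by lia))
      have e2 : (⁅coeff 1 y, coeff 0 x⁆ : SoB n).1 p q = 0 := by
        refine lie_apply_eq_zero (fun r h1 h2 => ?_) (fun r h1 h2 => ?_)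
        · have := entry_ne_star (k := 1) (x := y) h1
          exact h.not_full (basisPos_le _) (by lia) (hxA h2) hC
        · have := entry_ne_star (k := 1) (x := y) h2
          exact h.symm.not_full (basisPos_le _) (by lia) hC (hxA h1)
      rw [entry_eq, hone]
      change (⁅coeff 0 y, coeff 1 x⁆ : SoB n).1 p q + (⁅coeff 1 y, coeff 0 x⁆ : SoB n).1 p q +
        y.deg * (coeff 1 x).1 p q = 0
      rw [e1, e2, hx1]
      simp
    · exact absurd (Or.inl (by lia)) hk

/-- The ideal attached to a commuting pair. -/
def pairIdeal (h : IsCommutingPair n A C) : LieIdeal ℂ (affineBorel n) where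
  toSubmodule := (idealSpace n A C).comap (affineBorel n).toSubmodule.subtype
  lie_mem {y _} hx := h.lie_mem_idealSpace y.2 hx

lemma ambient_pairIdeal (h : IsCommutingPair n A C) : ambient (pairIdeal h) = idealSpace n A C := by
  rw [ambient, pairIdeal, Submodule.map_comap_subtype]
  exact inf_eq_right.mpr fun x hx => affineNilPlus_le_affineBorel hx.1

/-- Whether an entry is allowed depends only on its root. Hence the ideal meets each root space in
zero or in everything. -/
lemma allowed_of_rootFun_eq {k k' : ℤ} {p q p' q' : Idx n} (h : IsCommutingPair n A C)
    (he : rootFun k p q = rootFun k' p' q') (ha : Allowed A C k p q) : Allowed A C k' p' q' := by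
  obtain ⟨rfl, ⟨rfl, rfl⟩ | ⟨rfl, rfl⟩ | ⟨rfl, rfl⟩⟩ := eq_or_of_rootFun_eq he
  · rcases ha with ha | ⟨rfl, -⟩ | ⟨rfl, ha⟩
    · exact Or.inl ha
    · exact h.allowed_one_of_le le_rfl
    · exact absurd (h.left.lt_of_full ha) (lt_irrefl _)
  · exact ha
  · rwa [allowed_star]

lemma isBasicIdeal_pairIdeal (hn : 0 < n) (h : IsCommutingPair n A C) :
    IsBasicIdeal (pairIdeal h) := by
  refine ⟨⟨?_, ?_, fun α hα => ?_⟩, delta n, ⟨isPosRoot_delta hn, ?_⟩, Or.inl (Or.inl rfl)⟩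
  · rw [ambient_pairIdeal]
    exact fun x hx => hx.1
  -- Finite codimension: everything of degree at least 2 is allowed, so the ideal contains the
  -- kernel of the map recording the parts at `c`, `d`, `t ^ 0` and `t ^ 1`.
  · let φ : affineBorel n →ₗ[ℂ] ℂ × ℂ × SoB n × SoB n :=
      (centralₗ.prod (degₗ.prod ((coeff 0).prod (coeff 1)))) ∘ₗ (affineBorel n).toSubmodule.subtype
    have hφ : LinearMap.ker φ ≤ (pairIdeal h).toSubmodule := by
      intro x hx
      have hx' : φ x = 0 := hx
      have hc : (x : AffineB n).central = 0 := congrArg (fun t => t.1) hx'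
      have hd : (x : AffineB n).deg = 0 := congrArg (fun t => t.2.1) hx'
      have h0 : coeff 0 (x : AffineB n) = 0 := congrArg (fun t => t.2.2.1) hx'
      have h1 : coeff 1 (x : AffineB n) = 0 := congrArg (fun t => t.2.2.2) hx'
      have hneg := (coeff_of_mem_affineBorel x.2).1
      refine mem_idealSpace.mpr ⟨mem_affineNilPlus_iff.mpr ⟨hc, hd, hneg, ?_⟩, fun k p q hk => ?_⟩
      · change coeff 0 (x : AffineB n) ∈ _
        rw [h0]; exact zero_mem _
      · left
        by_contra! hlt
        apply hk
        change (coeff k (x : AffineB n)).1 p q = 0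
        rcases (show k < 0 ∨ k = 0 ∨ k = 1 by lia) with hk | rfl | rfl
        · rw [hneg k hk]; rfl
        · rw [h0]; rfl
        · rw [h1]; rfl
    have : FiniteDimensional ℂ (affineBorel n ⧸ LinearMap.ker φ) :=
      φ.quotKerEquivRange.symm.finiteDimensional
    exact Module.Finite.of_surjective (Submodule.factor hφ) (Submodule.factor_surjective hφ)
  · rw [ambient_pairIdeal, or_iff_not_imp_left]
    intro hne
    refine inf_eq_right.mpr fun y hy => ?_
    obtain ⟨x, ⟨hxI, hxα⟩, hx0⟩ := Submodule.exists_mem_ne_zero_of_ne_bot hne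
    refine mem_idealSpace.mpr ⟨hα.2.2 hy, fun k p q hk => ?_⟩
    obtain ⟨k', p', q', hk'⟩ : ∃ k' p' q', entry k' p' q' x ≠ 0 := by
      by_contra! hz
      obtain ⟨hc, hd⟩ := central_deg_of_mem_rootSpace hα.1 hxα
      exact hx0 (ext_entry (fun k p q => by rw [hz, map_zero]) hc hd)
    exact allowed_of_rootFun_eq h
      ((eq_rootFun_of_entry_ne_zero hxα hk').symm.trans (eq_rootFun_of_entry_ne_zero hy hk))
      ((mem_idealSpace.mp hxI).2 _ _ _ hk')
  · rw [ambient_pairIdeal]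
    intro x hx
    refine mem_idealSpace.mpr ⟨(isPosRoot_delta hn).2.2 hx, fun k p q hk => ?_⟩
    obtain ⟨rfl, rfl⟩ := entry_of_mem_rootSpace_delta hx hk
    exact h.allowed_one_of_le le_rfl

lemma rootVec_mem_idealSpace_iff {k : ℤ} {p q : Idx n} (hs : q ≠ star p)
    (hpos : 0 < k ∨ (k = 0 ∧ basisPos p < basisPos q)) :
    rootVec k p q ∈ idealSpace n A C ↔ Allowed A C k p q := by
  rw [mem_idealSpace]
  constructor
  · intro h
    exact h.2 k p q (entry_rootVec_self k hs)
  · intro h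
    refine ⟨rootVec_mem_affineNilPlus hpos, fun m a b hm => ?_⟩
    obtain ⟨rfl, ⟨rfl, rfl⟩ | ⟨rfl, rfl⟩⟩ := eq_or_of_entry_rootVec_ne_zero hm
    · exact h
    · rwa [allowed_star]

lemma allowed_zero_iff {p q : Idx n} (h : basisPos p + basisPos q < 2 * n) :
    Allowed A C 0 p q ↔ (basisPos p, basisPos q) ∈ A := by
  unfold Allowed Full
  constructor
  · rintro (h1 | h1 | ⟨-, h1 | h1⟩)
    · lia
    · lia
    · exact h1.2
    · lia
  · exact fun h1 => Or.inr (Or.inr ⟨rfl, Or.inl ⟨h, h1⟩⟩)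

lemma allowed_one_iff {p q : Idx n} (h : basisPos p + basisPos q < 2 * n) :
    Allowed A C 1 q p ↔ (basisPos p, basisPos q) ∉ C := by
  unfold Allowed Full
  constructor
  · rintro (h1 | ⟨-, h1⟩ | h1)
    · lia
    · exact fun hc => h1 (Or.inl ⟨h, hc⟩)
    · lia
  · refine fun h1 => Or.inr (Or.inl ⟨rfl, ?_⟩)
    rintro (h2 | h2)
    · exact h1 h2.2
    · lia

/-- A commuting pair is determined by its ideal. -/
lemma pair_eq_of_idealSpace_eq {A' C' : Set (ℕ × ℕ)} (h : IsCommutingPair n A C)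
    (h' : IsCommutingPair n A' C') (he : idealSpace n A C = idealSpace n A' C') :
    A = A' ∧ C = C' := by
  have key : ∀ x ∈ rootTri n, (x ∈ A ↔ x ∈ A') ∧ (x ∈ C ↔ x ∈ C') := by
    rintro ⟨i, j⟩ ⟨hij, hs⟩
    simp only at hij hs
    obtain ⟨p, rfl⟩ := exists_basisPos_eq (n := n) (k := i) (by lia)
    obtain ⟨q, rfl⟩ := exists_basisPos_eq (n := n) (k := j) (by lia)
    have hq : q ≠ star p := fun hq => by rw [eq_star_iff] at hq; lia
    have hp : p ≠ star q := fun hp => by rw [eq_star_iff] at hp; lia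
    constructor
    · rw [← allowed_zero_iff (C := C) hs, ← allowed_zero_iff (C := C') hs,
        ← rootVec_mem_idealSpace_iff hq (Or.inr ⟨rfl, hij⟩),
        ← rootVec_mem_idealSpace_iff hq (Or.inr ⟨rfl, hij⟩), he]
    · rw [← not_iff_not, ← allowed_one_iff (A := A) hs, ← allowed_one_iff (A := A') hs,
        ← rootVec_mem_idealSpace_iff hp (Or.inl one_pos),
        ← rootVec_mem_idealSpace_iff hp (Or.inl one_pos), he]
  refine ⟨Set.ext fun x => ⟨fun hx => ?_, fun hx => ?_⟩, Set.ext fun x => ⟨fun hx => ?_, fun hx => ?_⟩⟩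
  · exact (key x (h.left.subset hx)).1.mp hx
  · exact (key x (h'.left.subset hx)).1.mpr hx
  · exact (key x (h.right.subset hx)).2.mp hx
  · exact (key x (h'.right.subset hx)).2.mpr hx

end TypeB
end

/-! ### The commuting pair of a basic ideal -/

noncomputable section

namespace TypeB

open UntwistedAffine

variable {n : ℕ} {I : LieIdeal ℂ (affineBorel n)}

lemma lie_mem_ambient {x y : AffineB n} (hy : y ∈ affineBorel n) (hx : x ∈ ambient I) :
    ⁅y, x⁆ ∈ ambient I := by
  obtain ⟨x, hx, rfl⟩ := hx
  exact ⟨⁅(⟨y, hy⟩ : affineBorel n), x⁆, I.lie_mem hx, rfl⟩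

lemma lie_mem_ambient_left {x y : AffineB n} (hx : x ∈ ambient I) (hy : y ∈ affineBorel n) :
    ⁅x, y⁆ ∈ ambient I := by
  rw [← lie_skew]
  exact neg_mem (lie_mem_ambient hy hx)

lemma ambient_injective : Function.Injective (ambient : LieIdeal ℂ (affineBorel n) → _) := by
  intro I J h
  exact LieSubmodule.toSubmodule_injective
    (Submodule.map_injective_of_injective (Submodule.subtype_injective _) h)

/-- Other weights can be removed from an element of an ideal by the action of the Cartan
subalgebra. -/
lemma exists_mem_ambient_of_entry_ne_zero {k : ℤ} {p q : Idx n} (F : Finset (ℤ × Idx n × Idx n))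
    (hF : ∀ e ∈ F, rootFun e.1 e.2.1 e.2.2 ≠ rootFun k p q) {x : AffineB n} (hx : x ∈ ambient I)
    (hne : entry k p q x ≠ 0) :
    ∃ y ∈ ambient I, entry k p q y ≠ 0 ∧ (∀ e ∈ F, entry e.1 e.2.1 e.2.2 y = 0) ∧
      ∀ m a b, entry m a b x = 0 → entry m a b y = 0 := by
  classical
  induction F using Finset.induction_on with
  | empty => exact ⟨x, hx, hne, by simp, fun _ _ _ h => h⟩
  | insert e F _ ih =>
    obtain ⟨y, hy, hy1, hy2, hy3⟩ := ih fun e he => hF e (Finset.mem_insert_of_mem he)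
    obtain ⟨t, ht⟩ : ∃ t, rootFun e.1 e.2.1 e.2.2 t ≠ rootFun k p q t := by
      by_contra! h
      exact hF e (Finset.mem_insert_self _ _) (LinearMap.ext h)
    -- The operator `ad t - rootFun e t` scales each entry by a difference of weights at `t`. It
    -- kills the entry `e`, keeps the entry `(k, p, q)` nonzero by the choice of `t`, and creates no
    -- new entries.
    have key : ∀ m a b, entry m a b (⁅(t : AffineB n), y⁆ - rootFun e.1 e.2.1 e.2.2 t • y) =
        (rootFun m a b t - rootFun e.1 e.2.1 e.2.2 t) * entry m a b y := by
      intro m a b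
      rw [map_sub, map_smul, entry_cartan_lie, smul_eq_mul, sub_mul]
    refine ⟨⁅(t : AffineB n), y⁆ - rootFun e.1 e.2.1 e.2.2 t • y, ?_, ?_, ?_, ?_⟩
    · exact sub_mem (lie_mem_ambient (affineCartan_le_affineBorel t.2) hy)
        (Submodule.smul_mem _ _ hy)
    · rw [key]
      exact mul_ne_zero (sub_ne_zero.mpr ht.symm) hy1
    · intro f hf
      rw [key]
      rcases Finset.mem_insert.mp hf with rfl | hf
      · rw [sub_self, zero_mul]
      · rw [hy2 f hf, mul_zero]
    · intro m a b h
      rw [key, hy3 m a b h, mul_zero]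

/-- An element has finitely many nonzero degrees, so only finitely many entries of other weights
have to be removed. -/
lemma exists_mem_rootSpace_of_entry_ne_zero (hI : ambient I ≤ affineNilPlus n) {k : ℤ}
    {p q : Idx n} {x : AffineB n} (hx : x ∈ ambient I) (hne : entry k p q x ≠ 0) :
    ∃ y ∈ ambient I, y ∈ affineRootSpace n (rootFun k p q) ∧ entry k p q y ≠ 0 := by
  classical
  obtain ⟨s, hs⟩ := exists_finset_coeff_eq_zero x
  obtain ⟨y, hy, hy1, hy2, hy3⟩ := exists_mem_ambient_of_entry_ne_zero (k := k) (p := p) (q := q)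
    ((s ×ˢ (Finset.univ : Finset (Idx n × Idx n))).filter
      fun e => rootFun e.1 e.2.1 e.2.2 ≠ rootFun k p q)
    (fun e he => (Finset.mem_filter.mp he).2) hx hne
  obtain ⟨hc, hd, -, -⟩ := mem_affineNilPlus_iff.mp (hI hy)
  refine ⟨y, hy, fun t => ext_entry (fun m a b => ?_) ?_ ?_, hy1⟩
  · rw [entry_cartan_lie, map_smul, smul_eq_mul]
    by_cases hr : rootFun m a b = rootFun k p q
    · rw [hr]
    · have : entry m a b y = 0 := by
        by_cases hm : m ∈ s
        · exact hy2 (m, a, b) (by simp [hm, hr])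
        · refine hy3 m a b ?_
          rw [entry_eq, hs m hm]
          rfl
      rw [this, mul_zero, mul_zero]
  · rw [central_cartan_lie, smul_eq_mk, hc, smul_zero]
  · rw [deg_lie, smul_eq_mk, hd, smul_zero]

/-- Off the diagonal the root space is a line, so the component of this weight is a nonzero multiple
of the root vector. -/
lemma rootVec_mem_ambient_of_entry_ne_zero (hI : ambient I ≤ affineNilPlus n) {k : ℤ} {p q : Idx n}
    (hpq : p ≠ q) {x : AffineB n} (hx : x ∈ ambient I) (hne : entry k p q x ≠ 0) :
    rootVec k p q ∈ ambient I := by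
  obtain ⟨y, hy, hyr, hy1⟩ := exists_mem_rootSpace_of_entry_ne_zero hI hx hne
  have hzero : ∀ m a b, rootFun m a b ≠ rootFun k p q → entry m a b y = 0 := by
    intro m a b hr
    by_contra h
    exact hr (eq_rootFun_of_entry_ne_zero hyr h).symm
  have hq : q ≠ star p := fun h => entry_ne_star hne (eq_star_iff.mp h)
  have hr := entry_rootVec_self k hq
  obtain ⟨hc, hd, -, -⟩ := mem_affineNilPlus_iff.mp (hI hy)
  set z := y - (entry k p q y / entry k p q (rootVec k p q)) • rootVec k p q with hz
  have hz1 : entry k p q z = 0 := by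
    rw [hz, map_sub, map_smul, smul_eq_mul, div_mul_cancel₀ _ hr, sub_self]
  have hz0 : z = 0 := by
    refine ext_entry (fun m a b => ?_) ?_ ?_
    · rw [map_zero]
      by_cases h : rootFun k p q = rootFun m a b
      · obtain ⟨rfl, ⟨h1, -⟩ | ⟨rfl, rfl⟩ | ⟨rfl, rfl⟩⟩ := eq_or_of_rootFun_eq h
        · exact absurd h1 hpq
        · exact hz1
        · exact (entry_star_eq_zero_iff _ _ _).mpr hz1
      · rw [hz, map_sub, map_smul, hzero m a b (Ne.symm h), zero_sub]
        have : entry m a b (rootVec k p q) = 0 := by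
          by_contra hn
          exact h (eq_rootFun_of_entry_ne_zero (rootVec_mem_rootSpace k p q) hn)
        rw [this, smul_zero, neg_zero]
    · change centralₗ z = 0
      rw [hz, map_sub, map_smul]
      change y.central - _ • (0 : ℂ) = 0
      rw [hc, smul_zero, sub_zero]
    · change degₗ z = 0
      rw [hz, map_sub, map_smul]
      change y.deg - _ • (0 : ℂ) = 0
      rw [hd, smul_zero, sub_zero]
  have hy' : (entry k p q y / entry k p q (rootVec k p q)) • rootVec k p q ∈ ambient I := by
    have hyz := sub_eq_zero.mp (hz.symm.trans hz0)
    rw [← hyz]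
    exact hy
  exact (Submodule.smul_mem_iff _ (div_ne_zero hy1 hr)).mp hy'

lemma rootVec_mem_affineBorel {k : ℤ} {p q : Idx n}
    (h : 0 < k ∨ (k = 0 ∧ basisPos p < basisPos q)) : rootVec k p q ∈ affineBorel n :=
  affineNilPlus_le_affineBorel (rootVec_mem_affineNilPlus h)

lemma mem_of_formWeight_smul_mem {W : Submodule ℂ (AffineB n)} {p : Idx n} {x : AffineB n}
    (h : formWeight p • x ∈ W) : x ∈ W :=
  (Submodule.smul_mem_iff W (formWeight_ne_zero p)).mp h

/-- Bracketing a root vector of an ideal with a root vector of the Borel subalgebra on the left. -/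
lemma rootVec_mem_ambient_left {k m j : ℤ} (hj : k + m = j) {p q r : Idx n}
    (hb : 0 < k ∨ (k = 0 ∧ basisPos p < basisPos q)) (hm : 0 ≤ m) (h : rootVec m q r ∈ ambient I)
    (hqr : q ≠ star r) (hqp : q ≠ star p) (hpr : p ≠ r) : rootVec j p r ∈ ambient I := by
  have h1 := lie_mem_ambient (rootVec_mem_affineBorel hb) h
  rw [rootVec_lie k m (by lia) hqr hqp hpr, hj] at h1
  exact mem_of_formWeight_smul_mem h1

/-- Bracketing a root vector of an ideal with a root vector of the Borel subalgebra on the right. -/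
lemma rootVec_mem_ambient_right {k m j : ℤ} (hj : k + m = j) {p q r : Idx n} (hk : 0 ≤ k)
    (h : rootVec k p q ∈ ambient I) (hb : 0 < m ∨ (m = 0 ∧ basisPos q < basisPos r))
    (hqr : q ≠ star r) (hqp : q ≠ star p) (hpr : p ≠ r) : rootVec j p r ∈ ambient I := by
  have h1 := lie_mem_ambient_left h (rootVec_mem_affineBorel hb)
  rw [rootVec_lie k m (by lia) hqr hqp hpr, hj] at h1
  exact mem_of_formWeight_smul_mem h1

lemma lie_rootMat_apply_self {p q : Idx n} (hp : p ≠ star p) (hq : q ≠ star p) (hpq : p ≠ q) :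
    (⁅rootMat p q, rootMat q p⁆ : SoB n).1 p p ≠ 0 := by
  have hqp : p ≠ star q := fun h => hq (by rw [h, star_star])
  rw [coe_lie_apply, Finset.sum_eq_single q, Finset.sum_eq_zero, sub_zero, rootMat_apply_self hq,
    rootMat_apply_self hqp]
  · exact mul_ne_zero (formWeight_ne_zero _) (formWeight_ne_zero _)
  · intro r _
    rw [rootMat_apply_of_ne (a := p) (b := r), zero_mul]
    · rintro ⟨h, -⟩; exact hpq h.symm
    · rintro ⟨h, -⟩; exact hp h.symm
  · intro r _ hr
    rw [rootMat_apply_of_ne (p := p) (q := q), zero_mul]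
    · rintro ⟨-, h⟩; exact hr h.symm
    · rintro ⟨h, -⟩; exact hqp h.symm
  · simp

/-! ### The root space of `δ` and its consequences in higher degree -/

/-- A basic ideal contains the root space of `δ`. -/
lemma rootSpace_delta_le (hn : 0 < n) (hI : IsBasicIdeal I) :
    affineRootSpace n (delta n) ≤ ambient I := by
  obtain ⟨⟨hI1, -, hI3⟩, β, ⟨hβ, hβI⟩, hD⟩ := hI
  have key : ∀ p q : Idx n, p ≠ star p → q ≠ star p → p ≠ q →
      monomial 1 ⁅rootMat p q, rootMat q p⁆ ∈ ambient I →
      affineRootSpace n (delta n) ≤ ambient I := by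
    intro p q hp hq hpq hmem
    have hentry : entry 1 p p (monomial 1 ⁅rootMat p q, rootMat q p⁆) ≠ 0 := by
      rw [entry_eq, coeff_monomial, if_pos rfl]
      exact lie_rootMat_apply_self hp hq hpq
    -- The root space of `δ` need not be a line, so one nonzero vector in the ideal gives all of it
    -- only through the zero-or-everything condition.
    obtain h | h := hI3 _ (isPosRoot_delta hn)
    · exfalso
      obtain ⟨y, hy, hyδ, hy1⟩ := exists_mem_rootSpace_of_entry_ne_zero hI1 hmem hentry
      rw [← delta_eq_rootFun] at hyδ
      have : y ∈ ambient I ⊓ affineRootSpace n (delta n) := ⟨hy, hyδ⟩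
      rw [h, Submodule.mem_bot] at this
      rw [this, map_zero] at hy1
      exact hy1 rfl
    · rw [← h]
      exact inf_le_left
  rcases hD with (rfl | hγ) | ⟨γ, hγ, rfl⟩
  · exact hβI
  · obtain ⟨p, q, rfl, hpq, hq, hp⟩ := exists_rootFun_of_mem_finPosRoots hγ
    refine key p q hp hq (by rintro rfl; lia) ?_
    have h1 := lie_mem_ambient_left (hβI (rootVec_mem_rootSpace 0 p q))
      (rootVec_mem_affineBorel (k := 1) (p := q) (q := p) (Or.inl one_pos))
    rw [rootVec, rootVec, monomial_lie_monomial] at h1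
    simpa using h1
  · obtain ⟨p, q, rfl, hpq, hq, hp⟩ := exists_rootFun_of_mem_finPosRoots hγ
    refine key p q hp hq (by rintro rfl; lia) ?_
    have h0 : delta n - rootFun 0 p q = rootFun 1 q p := by
      simp only [rootFun, Int.cast_zero, Int.cast_one, zero_smul, one_smul]
      abel
    rw [h0] at hβI
    have h1 := lie_mem_ambient
      (rootVec_mem_affineBorel (k := 0) (p := p) (q := q) (Or.inr ⟨rfl, hpq⟩))
      (hβI (rootVec_mem_rootSpace 1 q p))
    rw [rootVec, rootVec, monomial_lie_monomial] at h1
    simpa using h1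

lemma rootVec_one_self_mem (hI : affineRootSpace n (delta n) ≤ ambient I) (p : Idx n) :
    rootVec 1 p p ∈ ambient I := hI (by
  rw [delta_eq_rootFun p]
  exact rootVec_mem_rootSpace 1 p p)

lemma eq_inl_of_eq_star {p : Idx n} (h : p = star p) : p = Sum.inl () := by
  rcases p with _ | _ | _ <;> simp_all [star]

lemma rootVec_antidiag (k : ℤ) (p : Idx n) : rootVec k p (star p) = 0 := by
  have h := rootVec_star k p (star p)
  rw [star_star] at h
  have h2 : (2 : ℂ) • rootVec k p (star p) = 0 := by
    rw [two_smul]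
    nth_rewrite 2 [h]
    rw [add_neg_cancel]
  exact (smul_eq_zero.mp h2).resolve_left two_ne_zero

/-- Bracketing with `rootVec 1 p p`, which has weight `δ`, raises the degree of the root vector at
`(p, q)` by one. When `p` is the index of `u_0` this element vanishes, and `rootVec 1 q q` is used
instead. -/
lemma rootVec_mem_of_delta_of_ne (hI : affineRootSpace n (delta n) ≤ ambient I) {k : ℤ}
    {p q : Idx n} (hpq : p ≠ q) (hk : 2 ≤ k ∨ (k = 1 ∧ basisPos p < basisPos q)) :
    rootVec k p q ∈ ambient I := by
  by_cases hq : q = star p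
  · rw [hq, rootVec_antidiag]; exact zero_mem _
  have hk' : 0 < k - 1 ∨ (k - 1 = 0 ∧ basisPos p < basisPos q) := by
    rcases hk with hk | ⟨rfl, hk⟩
    · left; lia
    · exact Or.inr ⟨by lia, hk⟩
  by_cases hp : p = star p
  · have hq' : q ≠ star q := fun h => hpq
      ((eq_inl_of_eq_star hp).trans (eq_inl_of_eq_star h).symm)
    exact rootVec_mem_ambient_left (k := k - 1) (m := 1) (by lia) hk' (by lia)
      (rootVec_one_self_mem hI q) hq' hq hpq
  · exact rootVec_mem_ambient_right (k := 1) (m := k - 1) (by lia) (by lia)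
      (rootVec_one_self_mem hI p) hk' (fun h => hq (by rw [h, star_star])) hp hpq

/-- The vector is half a bracket of root vectors at `(p, 0)` and `(0, p)`, where `0` stands for
`u_0`. The factor above the diagonal is given degree 1, where it is already known to lie in the
ideal. -/
lemma rootVec_self_mem_of_delta (hI : affineRootSpace n (delta n) ≤ ambient I) {k : ℤ} (hk : 2 ≤ k)
    (p : Idx n) : rootVec k p p ∈ ambient I := by
  by_cases hp : p = Sum.inl ()
  · have : p = star p := by rw [hp]; rfl
    nth_rewrite 2 [this]
    rw [rootVec_antidiag]
    exact zero_mem _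
  have h2 : ∀ a b : ℤ, 0 < a → a + b = k → ⁅rootVec a p (Sum.inl ()), rootVec b (Sum.inl ()) p⁆ =
      (2 : ℂ) • rootVec k p p := by
    intro a b ha hab
    rw [rootVec, rootVec, monomial_lie_monomial, rootMat_lie_middle hp, monomial_smul,
      if_neg (by lia), zero_smul, add_zero, hab]
    rfl
  refine (Submodule.smul_mem_iff _ (two_ne_zero (α := ℂ))).mp ?_
  rcases lt_or_gt_of_ne (basisPos_injective.ne hp) with h | h
  · rw [← h2 1 (k - 1) one_pos (by lia)]
    exact lie_mem_ambient_left (rootVec_mem_of_delta_of_ne hI hp (Or.inr ⟨rfl, h⟩))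
      (rootVec_mem_affineBorel (Or.inl (by lia)))
  · rw [← h2 (k - 1) 1 (by lia) (by lia)]
    exact lie_mem_ambient (rootVec_mem_affineBorel (Or.inl (by lia)))
      (rootVec_mem_of_delta_of_ne hI (Ne.symm hp) (Or.inr ⟨rfl, h⟩))

/-! ### The commuting pair attached to an ideal -/

lemma isUpper_of_step {A : Set (ℕ × ℕ)} (h : A ⊆ rootTri n)
    (h1 : ∀ i q, (i + 1, q) ∈ A → (i, q) ∈ A)
    (h2 : ∀ i q, (i, q) ∈ A → (i, q + 1) ∈ rootTri n → (i, q + 1) ∈ A) : IsUpper n A := by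
  refine ⟨h, fun {i q i' q'} hA ht hi hq => ?_⟩
  have hrow : (i', q) ∈ A := by
    induction i, hi using Nat.le_induction with
    | base => exact hA
    | succ i _ ih => exact ih (h1 i q hA)
  induction q', hq using Nat.le_induction with
  | base => exact hrow
  | succ q' hq ih =>
    have hlt := (h hrow).1
    refine h2 i' q' (ih ⟨?_, ?_⟩) ht
    · simp only at hlt ⊢; lia
    · have := ht.2
      simp only at this ⊢; lia

/-- The positive roots of `B_n` in the support of an ideal. -/
def lowerRoots (I : LieIdeal ℂ (affineBorel n)) : Set (ℕ × ℕ) :=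
  {x | x ∈ rootTri n ∧ ∃ p q : Idx n, basisPos p = x.1 ∧ basisPos q = x.2 ∧
    rootVec 0 p q ∈ ambient I}

/-- The positive roots `γ` of `B_n` with `δ - γ` not in the support of an ideal. -/
def missingRoots (I : LieIdeal ℂ (affineBorel n)) : Set (ℕ × ℕ) :=
  {x | x ∈ rootTri n ∧ ∃ p q : Idx n, basisPos p = x.1 ∧ basisPos q = x.2 ∧
    rootVec 1 q p ∉ ambient I}

lemma mem_lowerRoots {p q : Idx n} : (basisPos p, basisPos q) ∈ lowerRoots I ↔
    (basisPos p, basisPos q) ∈ rootTri n ∧ rootVec 0 p q ∈ ambient I := by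
  refine and_congr_right fun _ => ⟨?_, fun h => ⟨p, q, rfl, rfl, h⟩⟩
  rintro ⟨p', q', hp, hq, h⟩
  rwa [← basisPos_injective hp, ← basisPos_injective hq]

lemma mem_missingRoots {p q : Idx n} : (basisPos p, basisPos q) ∈ missingRoots I ↔
    (basisPos p, basisPos q) ∈ rootTri n ∧ rootVec 1 q p ∉ ambient I := by
  refine and_congr_right fun _ => ⟨?_, fun h => ⟨p, q, rfl, rfl, h⟩⟩
  rintro ⟨p', q', hp, hq, h⟩
  rwa [← basisPos_injective hp, ← basisPos_injective hq]

lemma ne_star_of_add_ne {p q : Idx n} (h : basisPos p + basisPos q ≠ 2 * n) : p ≠ star q :=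
  fun hp => h (by rw [add_comm]; exact eq_star_iff.mp hp)

lemma ne_of_basisPos_ne {p q : Idx n} (h : basisPos p ≠ basisPos q) : p ≠ q := fun hp => h (hp ▸ rfl)

lemma isUpper_lowerRoots : IsUpper n (lowerRoots I) := by
  refine isUpper_of_step (fun x hx => hx.1) (fun i j h => ?_) (fun i j h ht => ?_)
  · obtain ⟨⟨h1, h2⟩, p, q, hp, hq, hr⟩ := h
    simp only at h1 h2 hp hq
    obtain ⟨p', rfl⟩ := exists_basisPos_eq (n := n) (k := i) (by lia)
    subst hq
    refine mem_lowerRoots.mpr ⟨⟨by simp only; lia, by simp only; lia⟩, ?_⟩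
    exact rootVec_mem_ambient_left (add_zero 0) (Or.inr ⟨rfl, by lia⟩) le_rfl hr
      (ne_star_of_add_ne (by lia)) (ne_star_of_add_ne (by lia)) (ne_of_basisPos_ne (by lia))
  · obtain ⟨⟨h1, h2⟩, p, q, hp, hq, hr⟩ := h
    obtain ⟨h3, h4⟩ := ht
    simp only at h1 h2 h3 h4 hp hq
    obtain ⟨q', hq'⟩ := exists_basisPos_eq (n := n) (k := j + 1) (by lia)
    rw [← hp, ← hq']
    refine mem_lowerRoots.mpr ⟨⟨by simp only; lia, by simp only; lia⟩, ?_⟩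
    exact rootVec_mem_ambient_right (add_zero 0) le_rfl hr (Or.inr ⟨rfl, by lia⟩)
      (ne_star_of_add_ne (by lia)) (ne_star_of_add_ne (by lia)) (ne_of_basisPos_ne (by lia))

/-- Contrapositive form: adding a positive root to `δ - γ` stays in the support, so passing to a
smaller `γ` preserves membership of `δ - γ`. -/
lemma isUpper_missingRoots : IsUpper n (missingRoots I) := by
  refine isUpper_of_step (fun x hx => hx.1) (fun i j h => ?_) (fun i j h ht => ?_)
  · obtain ⟨⟨h1, h2⟩, p, q, hp, hq, hr⟩ := h
    simp only at h1 h2 hp hq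
    obtain ⟨p', rfl⟩ := exists_basisPos_eq (n := n) (k := i) (by lia)
    subst hq
    refine mem_missingRoots.mpr ⟨⟨by simp only; lia, by simp only; lia⟩, fun hc => hr ?_⟩
    exact rootVec_mem_ambient_right (add_zero 1) (by lia) hc (Or.inr ⟨rfl, by lia⟩)
      (ne_star_of_add_ne (by lia)) (ne_star_of_add_ne (by lia)) (ne_of_basisPos_ne (by lia))
  · obtain ⟨⟨h1, h2⟩, p, q, hp, hq, hr⟩ := h
    obtain ⟨h3, h4⟩ := ht
    simp only at h1 h2 h3 h4 hp hq
    obtain ⟨q', hq'⟩ := exists_basisPos_eq (n := n) (k := j + 1) (by lia)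
    rw [← hp, ← hq']
    refine mem_missingRoots.mpr ⟨⟨by simp only; lia, by simp only; lia⟩, fun hc => hr ?_⟩
    exact rootVec_mem_ambient_left (zero_add 1) (Or.inr ⟨rfl, by lia⟩) (by lia) hc
      (ne_star_of_add_ne (by lia)) (ne_star_of_add_ne (by lia)) (ne_of_basisPos_ne (by lia))

/-- If `(r, q)` is in the support of an ideal, then so is `δ` minus the root `(a, -q)`. -/
lemma rootVec_one_star_mem {r q a : Idx n} (h : rootVec 0 r q ∈ ambient I)
    (hrq : basisPos r + basisPos q ≠ 2 * n) (hra : basisPos r ≠ basisPos a)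
    (haq : basisPos a + basisPos q ≠ 2 * n) : rootVec 1 (star q) a ∈ ambient I := by
  have ha := basisPos_star a
  have ha' := basisPos_le a
  -- The bracketing vector `rootVec 1 (star a) r` has weight `δ - e_a - e_r`; adding `e_r - e_q`
  -- leaves `δ - e_a - e_q`.
  have h1 : rootVec 1 (star a) q ∈ ambient I :=
    rootVec_mem_ambient_left (add_zero 1) (Or.inl one_pos) le_rfl h (ne_star_of_add_ne hrq)
      (ne_star_of_add_ne (by lia)) (ne_of_basisPos_ne (by lia))
  have h2 := rootVec_star 1 (star a) q
  rw [star_star] at h2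
  rw [h2]
  exact neg_mem h1

/-- In `rootVec_one_star_mem`, `r` and `a` are the first two basis vectors, in either order, so `e_r
+ e_a` is the highest root. -/
lemma isCommutingPair_roots : IsCommutingPair n (lowerRoots I) (missingRoots I) := by
  refine ⟨isUpper_lowerRoots, isUpper_missingRoots, fun k hk hk' hA hC => ?_,
    fun k hk hk' hC hA => ?_⟩
  · obtain ⟨-, r, q, hr, hq, hA⟩ := hA
    obtain ⟨-, a, b, ha, hb, hC⟩ := hC
    simp only at hr hq ha hb
    have hbq : b = star q := eq_star_iff.mpr (by lia)
    exact hC (hbq ▸ rootVec_one_star_mem hA (by lia) (by lia) (by lia))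
  · obtain ⟨-, r, q, hr, hq, hA⟩ := hA
    obtain ⟨-, a, b, ha, hb, hC⟩ := hC
    simp only at hr hq ha hb
    have hbq : b = star q := eq_star_iff.mpr (by lia)
    exact hC (hbq ▸ rootVec_one_star_mem hA (by lia) (by lia) (by lia))

lemma full_lowerRoots_iff {p q : Idx n} : Full n (lowerRoots I) (basisPos p) (basisPos q) ↔
    basisPos p < basisPos q ∧ basisPos p + basisPos q ≠ 2 * n ∧ rootVec 0 p q ∈ ambient I := by
  have hp := basisPos_le p
  have hq := basisPos_le q
  unfold Full
  rw [← basisPos_star, ← basisPos_star, mem_lowerRoots, mem_lowerRoots, rootVec_star, neg_mem_iff,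
    basisPos_star, basisPos_star]
  simp only [rootTri, Set.mem_ofPred_eq]
  constructor
  · rintro (⟨h1, h2, h3⟩ | ⟨h1, h2, h3⟩)
    · exact ⟨by lia, by lia, h3⟩
    · exact ⟨by lia, by lia, h3⟩
  · rintro ⟨h1, h2, h3⟩
    rcases lt_or_gt_of_ne h2 with h | h
    · exact Or.inl ⟨h, ⟨by lia, by lia⟩, h3⟩
    · exact Or.inr ⟨h, ⟨by lia, by lia⟩, h3⟩

lemma full_missingRoots_iff {p q : Idx n} : Full n (missingRoots I) (basisPos p) (basisPos q) ↔
    basisPos p < basisPos q ∧ basisPos p + basisPos q ≠ 2 * n ∧ rootVec 1 q p ∉ ambient I := by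
  have hp := basisPos_le p
  have hq := basisPos_le q
  unfold Full
  rw [← basisPos_star, ← basisPos_star, mem_missingRoots, mem_missingRoots, rootVec_star,
    neg_mem_iff, basisPos_star, basisPos_star]
  simp only [rootTri, Set.mem_ofPred_eq]
  constructor
  · rintro (⟨h1, h2, h3⟩ | ⟨h1, h2, h3⟩)
    · exact ⟨by lia, by lia, h3⟩
    · exact ⟨by lia, by lia, h3⟩
  · rintro ⟨h1, h2, h3⟩
    rcases lt_or_gt_of_ne h2 with h | h
    · exact Or.inl ⟨h, ⟨by lia, by lia⟩, h3⟩
    · exact Or.inr ⟨h, ⟨by lia, by lia⟩, h3⟩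

/-- A basic ideal is the ideal of the commuting pair of its roots. -/
lemma ambient_eq_idealSpace (hn : 0 < n) (hI : IsBasicIdeal I) :
    ambient I = idealSpace n (lowerRoots I) (missingRoots I) := by
  have hδ := rootSpace_delta_le hn hI
  have hN := hI.1.1
  have hpair := isCommutingPair_roots (I := I)
  apply le_antisymm
  · intro x hx
    refine mem_idealSpace.mpr ⟨hN hx, fun k p q hne => ?_⟩
    obtain ⟨-, -, hneg, h0⟩ := mem_affineNilPlus_iff.mp (hN hx)
    rcases lt_or_ge k 0 with hk | hk
    · exact absurd (by rw [entry_eq, hneg k hk]; rfl) hne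
    rcases hk.eq_or_lt with rfl | hk
    · have hpq : basisPos p < basisPos q := by
        by_contra! h
        exact hne (h0 p q h)
      exact Or.inr (Or.inr ⟨rfl, full_lowerRoots_iff.mpr ⟨hpq, entry_ne_star hne,
        rootVec_mem_ambient_of_entry_ne_zero hN (by rintro rfl; lia) hx hne⟩⟩)
    rcases (show 1 ≤ k by lia).eq_or_lt with rfl | hk
    · by_cases hpq : p = q
      · exact hpair.allowed_one_of_le (by rw [hpq])
      · refine Or.inr (Or.inl ⟨rfl, fun hf => ?_⟩)
        exact (full_missingRoots_iff.mp hf).2.2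
          (rootVec_mem_ambient_of_entry_ne_zero hN hpq hx hne)
    · exact Or.inl (by lia)
  · intro x hx
    obtain ⟨hx1, hx2⟩ := mem_idealSpace.mp hx
    obtain ⟨hc, hd, -, -⟩ := mem_affineNilPlus_iff.mp hx1
    obtain ⟨s, hs⟩ := exists_finset_coeff_eq_zero x
    rw [eq_sum_monomial hc hd hs]
    refine Submodule.sum_mem _ fun k _ => ?_
    -- It suffices to treat root vectors at positions where `x` has a nonzero, hence allowed, entry.
    rw [eq_sum_rootMat (coeff k x), monomial_smul, monomial_sum]
    refine Submodule.smul_mem _ _ (Submodule.sum_mem _ fun p _ => ?_)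
    rw [monomial_sum]
    refine Submodule.sum_mem _ fun q _ => ?_
    rw [monomial_smul]
    by_cases hne : (coeff k x).1 p q = 0
    · rw [hne, zero_div, zero_smul]; exact zero_mem _
    refine Submodule.smul_mem _ _ ?_
    change rootVec k p q ∈ _
    rcases hx2 k p q hne with hk | ⟨rfl, hk⟩ | ⟨rfl, hk⟩
    · by_cases hpq : p = q
      · rw [hpq]; exact rootVec_self_mem_of_delta hδ hk q
      · exact rootVec_mem_of_delta_of_ne hδ hpq (Or.inl hk)
    · rcases lt_trichotomy (basisPos p) (basisPos q) with h | h | h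
      · exact rootVec_mem_of_delta_of_ne hδ (by rintro rfl; lia) (Or.inr ⟨rfl, h⟩)
      · rw [basisPos_injective h]; exact rootVec_one_self_mem hδ q
      · by_contra hr
        have := entry_ne_star (k := 1) hne
        exact hk (full_missingRoots_iff.mpr ⟨h, by lia, hr⟩)
    · exact (full_lowerRoots_iff.mp hk).2.2

/-- Basic ideals correspond to commuting pairs of upper sets of positive roots. -/
lemma bijOn_basicIdeals (hn : 0 < n) :
    Set.BijOn (fun I : LieIdeal ℂ (affineBorel n) => (lowerRoots I, missingRoots I))
      {I | IsBasicIdeal I} {x | IsCommutingPair n x.1 x.2} := by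
  refine ⟨fun I _ => isCommutingPair_roots, fun I hI J hJ h => ?_, fun x hx => ?_⟩
  · apply ambient_injective
    rw [ambient_eq_idealSpace hn hI, ambient_eq_idealSpace hn hJ]
    rw [show lowerRoots I = lowerRoots J from congrArg Prod.fst h,
      show missingRoots I = missingRoots J from congrArg Prod.snd h]
  · have hb := isBasicIdeal_pairIdeal hn hx
    refine ⟨pairIdeal hx, hb, ?_⟩
    have h := pair_eq_of_idealSpace_eq (isCommutingPair_roots (I := pairIdeal hx)) hx
      ((ambient_eq_idealSpace hn hb).symm.trans (ambient_pairIdeal hx))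
    exact Prod.ext h.1 h.2

end TypeB
end

/-! ### Counting commuting pairs -/

noncomputable section

namespace TypeB

lemma encard_eq_sum_of_fibers {α ι : Type*} {s : Set α} (t : Finset ι) (r : ι → Set α)
    (h : ∀ x, x ∈ s ↔ ∃ i ∈ t, x ∈ r i) (hr : ∀ x i j, x ∈ r i → x ∈ r j → i = j) :
    s.encard = ∑ i ∈ t, (r i).encard := by
  have hs : s = ⋃ i ∈ (t : Set ι), r i := by
    ext x
    simp [h]
  rw [hs, t.finite_toSet.encard_biUnion, finsum_mem_coe_finset]
  intro i _ j _ hij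
  exact Set.disjoint_left.mpr fun x hi hj => hij (hr x i j hi hj)

lemma encard_eq_of_bijOn {α β : Type*} {s : Set α} {t : Set β} {f : α → β} (h : Set.BijOn f s t) :
    s.encard = t.encard := by
  rw [← h.image_eq, h.injOn.encard_image]

/-- The upper sets with `k` roots in the row of `e_1`. -/
def upperSets (n k : ℕ) : Set (Set (ℕ × ℕ)) :=
  {A | IsUpper n A ∧ k ≤ 2 * n - 1 ∧ ∀ q, (0, q) ∈ A ↔ 2 * n ≤ q + k ∧ q < 2 * n}

lemma exists_mem_upperSets {n : ℕ} {A : Set (ℕ × ℕ)} (h : IsUpper n A) : ∃ k, A ∈ upperSets n k := by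
  classical
  by_cases he : ∃ q, (0, q) ∈ A
  · have hs := Nat.find_spec he
    have ht := h.subset hs
    have h1 := ht.1
    have h2 := ht.2
    simp only at h1 h2
    -- Row 0 of an upper set is a final segment of the columns up to `2n - 1`, so its first column
    -- fixes its size.
    refine ⟨2 * n - Nat.find he, h, by lia, fun q => ⟨fun hq => ?_, fun hq => ?_⟩⟩
    · have h3 := Nat.find_min' he hq
      have h4 := (h.subset hq).2
      simp only at h4
      lia
    · exact h.mem_of_le hs ⟨by simp only; lia, by simp only; lia⟩ le_rfl (by lia)
  · refine ⟨0, h, Nat.zero_le _, fun q => ⟨fun hq => absurd ⟨q, hq⟩ he, fun hq => ?_⟩⟩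
    lia

lemma upperSets_unique {n j k : ℕ} {A : Set (ℕ × ℕ)} (hj : A ∈ upperSets n j)
    (hk : A ∈ upperSets n k) : j = k := by
  obtain ⟨-, hj1, hj2⟩ := hj
  obtain ⟨-, hk1, hk2⟩ := hk
  have h1 := (hj2 (2 * n - k)).symm.trans (hk2 (2 * n - k))
  have h2 := (hj2 (2 * n - j)).symm.trans (hk2 (2 * n - j))
  lia

/-- The restriction of a set of roots of `B_{n+1}` to `B_n`. -/
def dropRow (A : Set (ℕ × ℕ)) : Set (ℕ × ℕ) := {x | (x.1 + 1, x.2 + 1) ∈ A}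

lemma mem_dropRow {A : Set (ℕ × ℕ)} {i q : ℕ} : (i, q) ∈ dropRow A ↔ (i + 1, q + 1) ∈ A := Iff.rfl

lemma succ_mem_rootTri {n i q : ℕ} : (i + 1, q + 1) ∈ rootTri (n + 1) ↔ (i, q) ∈ rootTri n := by
  simp only [rootTri, Set.mem_ofPred_eq]
  lia

lemma IsUpper.dropRow {n : ℕ} {A : Set (ℕ × ℕ)} (h : IsUpper (n + 1) A) : IsUpper n (dropRow A) := by
  refine ⟨?_, ?_⟩
  · rintro ⟨i, q⟩ hx
    exact succ_mem_rootTri.mp (h.subset hx)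
  · intro i q i' q' hA ht hi hq
    exact h.mem_of_le (mem_dropRow.mp hA) (succ_mem_rootTri.mpr ht) (by lia) (by lia)

/-- The upper sets with fewer than `k` roots in the row of `e_1`, or none. -/
def smallUpperSets (n k : ℕ) : Set (Set (ℕ × ℕ)) :=
  {A | ∃ j ∈ Finset.range (max k 1), A ∈ upperSets n j}

/-- Row 0 ends one column further right than row 1. If row 1 has `j > 0` roots, it starts in column
`2n + 1 - j`, and row 0 must contain that column, which says `j < k`. An empty row 1 is always
possible, whence `max k 1`. -/
lemma bijOn_dropRow {n k : ℕ} (hk : k ≤ 2 * n + 1) :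
    Set.BijOn dropRow (upperSets (n + 1) k) (smallUpperSets n k) := by
  refine ⟨?_, ?_, ?_⟩
  · rintro A ⟨hA, hk', hrow⟩
    obtain ⟨j, hj⟩ := exists_mem_upperSets hA.dropRow
    refine ⟨j, ?_, hj⟩
    rw [Finset.mem_range]
    by_cases hj0 : j = 0
    · lia
    obtain ⟨-, hj1, hj2⟩ := hj
    have h1 := mem_dropRow.mp ((hj2 (2 * n - j)).mpr ⟨by lia, by lia⟩)
    have h2 := hA.mem_of_le (j := 0) h1 ⟨by simp only; lia, by simp only; lia⟩ (by lia) le_rfl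
    have h3 := (hrow _).mp h2
    lia
  · rintro A ⟨hA, -, hA2⟩ B ⟨hB, -, hB2⟩ hAB
    ext ⟨i, q⟩
    rcases i with _ | i
    · rw [hA2, hB2]
    · rcases q with _ | q
      · refine ⟨fun h => ?_, fun h => ?_⟩
        · exact absurd (hA.subset h).1 (by simp)
        · exact absurd (hB.subset h).1 (by simp)
      · rw [← mem_dropRow, ← mem_dropRow, hAB]
  · rintro B ⟨j, hj, hB, hj1, hj2⟩
    rw [Finset.mem_range] at hj
    -- The inverse prepends a row of `k` roots. The positivity conditions guard against truncated
    -- subtraction.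
    let A : Set (ℕ × ℕ) := {x | (x.1 = 0 ∧ 2 * (n + 1) ≤ x.2 + k ∧ x.2 < 2 * (n + 1)) ∨
      (0 < x.1 ∧ 0 < x.2 ∧ (x.1 - 1, x.2 - 1) ∈ B)}
    have hA0 : ∀ q, (0, q) ∈ A ↔ 2 * (n + 1) ≤ q + k ∧ q < 2 * (n + 1) := by
      intro q
      simp [A]
    have hA1 : ∀ i q, (i + 1, q + 1) ∈ A ↔ (i, q) ∈ B := by
      intro i q
      simp [A]
    have hA2 : ∀ i, (i + 1, 0) ∉ A := by
      intro i
      simp [A]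
    refine ⟨A, ⟨⟨?_, ?_⟩, by lia, hA0⟩, Set.ext fun ⟨i, q⟩ => (mem_dropRow.trans (hA1 i q))⟩
    · rintro ⟨i, q⟩ hx
      rcases i with _ | i
      · rw [hA0] at hx
        exact ⟨by simp only; lia, by simp only; lia⟩
      · rcases q with _ | q
        · exact absurd hx (hA2 i)
        · exact succ_mem_rootTri.mpr (hB.subset ((hA1 i q).mp hx))
    · intro i q i' q' hx ht hi hq
      have ht1 := ht.1
      have ht2 := ht.2
      simp only at ht1 ht2
      rcases i with _ | i
      · obtain rfl : i' = 0 := by lia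
        rw [hA0] at hx ⊢
        lia
      · rcases q with _ | q
        · exact absurd hx (hA2 i)
        · rw [hA1] at hx
          obtain ⟨q', rfl⟩ : ∃ r, q' = r + 1 := ⟨q' - 1, by lia⟩
          rcases i' with _ | i'
          · have h1 := (hB.subset hx).1
            have h2 := (hB.subset hx).2
            simp only at h1 h2
            have h3 := (hj2 q).mp (hB.mem_of_le hx ⟨by simp only; lia, by simp only; lia⟩
              (Nat.zero_le _) le_rfl)
            rw [hA0]
            lia
          · rw [hA1]
            exact hB.mem_of_le hx (succ_mem_rootTri.mp ht) (by lia) (by lia)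

/-- The number of upper sets with `k` roots in the row of `e_1`. -/
def upperCount : ℕ → ℕ → ℕ
  | 0, k => if k = 0 then 1 else 0
  | n + 1, k => if k ≤ 2 * n + 1 then ∑ j ∈ Finset.range (max k 1), upperCount n j else 0

lemma encard_smallUpperSets_eq_sum (n k : ℕ) :
    (smallUpperSets n k).encard = ∑ j ∈ Finset.range (max k 1), (upperSets n j).encard :=
  encard_eq_sum_of_fibers _ _ (fun _ => Iff.rfl) fun _ _ _ => upperSets_unique

lemma encard_upperSets (n k : ℕ) : (upperSets n k).encard = upperCount n k := by
  induction n generalizing k with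
  | zero =>
    have hu : IsUpper 0 ∅ := ⟨by simp, by simp⟩
    have he : ∀ A, IsUpper 0 A → A = ∅ := fun A hA =>
      Set.eq_empty_of_forall_notMem fun x hx => by
        have := (hA.subset hx).2
        lia
    rw [upperCount]
    split_ifs with hk
    · rw [show upperSets 0 k = {∅} from ?_]
      · simp
      · ext A
        refine ⟨fun h => he A h.1, ?_⟩
        rintro rfl
        exact ⟨hu, by lia, by simp⟩
    · rw [show upperSets 0 k = ∅ from ?_]
      · simp
      · exact Set.eq_empty_of_forall_notMem fun A hA => hk (by have := hA.2.1; lia)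
  | succ n ih =>
    rw [upperCount]
    split_ifs with hk
    · rw [encard_eq_of_bijOn (bijOn_dropRow hk), encard_smallUpperSets_eq_sum]
      simp only [ih]
      push_cast
      rfl
    · rw [show upperSets (n + 1) k = ∅ from ?_]
      · simp
      · exact Set.eq_empty_of_forall_notMem fun A hA => hk (by have := hA.2.1; lia)

lemma encard_smallUpperSets {n k : ℕ} (hk : k ≤ 2 * n + 1) :
    (smallUpperSets n k).encard = upperCount (n + 1) k := by
  rw [← encard_upperSets, encard_eq_of_bijOn (bijOn_dropRow hk)]

/-- Row 0 of `A` contains column `2(n + 1) - p` when `p ≤ k`, and row 1 of `C` contains column `p`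
when `p ≥ 2n + 1 - j`. A conflict exists exactly when `j > 0` and `2n + 1 - j ≤ k`, and `p = 2n + 1
- j` then realizes it. -/
lemma commuting_iff {n k j : ℕ} {A C : Set (ℕ × ℕ)} (hA : A ∈ upperSets (n + 1) k)
    (hC : dropRow C ∈ upperSets n j) :
    (∀ p, 2 ≤ p → p ≤ 2 * (n + 1) - 2 → (0, 2 * (n + 1) - p) ∈ A → (1, p) ∉ C) ↔
      j < max (2 * n + 1 - k) 1 := by
  obtain ⟨-, hk, hA⟩ := hA
  obtain ⟨-, hj, hC⟩ := hC
  constructor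
  · intro h
    by_contra! hlt
    refine h (2 * n + 1 - j) (by lia) (by lia) ((hA _).mpr (by lia)) ?_
    have := mem_dropRow.mp ((hC (2 * n - j)).mpr (by lia))
    rwa [show 2 * n - j + 1 = 2 * n + 1 - j by lia] at this
  · intro h p h2 hp h0 h1
    have h3 := (hA _).mp h0
    have h4 := (hC (p - 1)).mp (mem_dropRow.mpr (by rwa [show p - 1 + 1 = p by lia]))
    lia

/-- The number of commuting pairs. -/
lemma encard_commutingPairs (n : ℕ) :
    {x : Set (ℕ × ℕ) × Set (ℕ × ℕ) | IsCommutingPair (n + 1) x.1 x.2}.encard =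
      ((∑ x ∈ Finset.range (2 * n + 2) ×ˢ Finset.range (2 * n + 2),
        upperCount (n + 1) (min x.1 (2 * n + 1 - x.2)) *
          upperCount (n + 1) (min x.2 (2 * n + 1 - x.1)) : ℕ) : ℕ∞) := by
  rw [encard_eq_sum_of_fibers (Finset.range (2 * n + 2) ×ˢ Finset.range (2 * n + 2))
    (fun y => {x | IsCommutingPair (n + 1) x.1 x.2 ∧ x.1 ∈ upperSets (n + 1) y.1 ∧
      x.2 ∈ upperSets (n + 1) y.2})]
  · rw [Nat.cast_sum]
    refine Finset.sum_congr rfl ?_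
    rintro ⟨k, l⟩ hkl
    simp only [Finset.mem_product, Finset.mem_range] at hkl
    -- For rows 0 of sizes `k` and `l`, the first row of what remains of `A` is bounded through `k`
    -- by the upper set condition and through `2n + 1 - l` by commutation, and symmetrically for
    -- `C`. Each minimum combines the two bounds.
    rw [Nat.cast_mul, ← encard_smallUpperSets (by simp only; lia),
      ← encard_smallUpperSets (by simp only; lia), ← Set.encard_prod]
    have bk := bijOn_dropRow (n := n) (k := k) (by lia)
    have bl := bijOn_dropRow (n := n) (k := l) (by lia)
    refine encard_eq_of_bijOn (f := Prod.map dropRow dropRow) ⟨?_, ?_, ?_⟩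
    · rintro ⟨A, C⟩ ⟨h, hA, hC⟩
      obtain ⟨i, hi, hA'⟩ := bk.mapsTo hA
      obtain ⟨j, hj, hC'⟩ := bl.mapsTo hC
      rw [Finset.mem_range] at hi hj
      have h1 := (commuting_iff hA hC').mp h.not_left
      have h2 := (commuting_iff hC hA').mp h.not_right
      refine ⟨⟨i, ?_, hA'⟩, ⟨j, ?_, hC'⟩⟩ <;> rw [Finset.mem_range] <;> simp only <;> lia
    · rintro ⟨A, C⟩ ⟨_, hA, hC⟩ ⟨A', C'⟩ ⟨_, hA', hC'⟩ h
      exact Prod.ext (bk.injOn hA hA' (congrArg Prod.fst h)) (bl.injOn hC hC' (congrArg Prod.snd h))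
    · rintro ⟨A', C'⟩ ⟨⟨i, hi, hA'⟩, ⟨j, hj, hC'⟩⟩
      simp only [Finset.mem_range] at hi hj hA' hC'
      obtain ⟨A, hA, rfl⟩ := bk.surjOn ⟨i, by rw [Finset.mem_range]; lia, hA'⟩
      obtain ⟨C, hC, rfl⟩ := bl.surjOn ⟨j, by rw [Finset.mem_range]; lia, hC'⟩
      exact ⟨(A, C), ⟨⟨hA.1, hC.1, (commuting_iff hA hC').mpr (by lia),
        (commuting_iff hC hA').mpr (by lia)⟩, hA, hC⟩, rfl⟩
  · rintro ⟨A, C⟩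
    constructor
    · intro h
      obtain ⟨k, hk⟩ := exists_mem_upperSets h.left
      obtain ⟨l, hl⟩ := exists_mem_upperSets h.right
      refine ⟨(k, l), ?_, h, hk, hl⟩
      have h1 := hk.2.1
      have h2 := hl.2.1
      simp only [Finset.mem_product, Finset.mem_range]
      lia
    · rintro ⟨y, -, h, -⟩
      exact h
  · rintro ⟨A, C⟩ ⟨k, l⟩ ⟨k', l'⟩ ⟨_, h1, h2⟩ ⟨_, h3, h4⟩
    exact Prod.ext (upperSets_unique h1 h3) (upperSets_unique h2 h4)

end TypeB
end

/-! ### Evaluation of the count -/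

noncomputable section

namespace TypeB

open Finset

/-- The sum of the binomial coefficients `C(M, j)` with `j ≥ s`. -/
def chooseTail (M s : ℕ) : ℤ := ∑ i ∈ range (M + 1), (M.choose (s + i) : ℤ)

/-- The sum of `(j - s) C(M, j)` over `j ≥ s`. -/
def chooseMoment (M s : ℕ) : ℤ := ∑ i ∈ range (M + 1), (i : ℤ) * (M.choose (s + i) : ℤ)

lemma choose_add_eq_zero {M s i : ℕ} (h : M < i) : M.choose (s + i) = 0 :=
  Nat.choose_eq_zero_of_lt (by lia)

lemma chooseTail_eq_zero {M s : ℕ} (h : M < s) : chooseTail M s = 0 :=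
  sum_eq_zero fun i _ => by rw [Nat.choose_eq_zero_of_lt (by lia), Nat.cast_zero]

lemma chooseTail_succ (M s : ℕ) :
    chooseTail (M + 1) (s + 1) = chooseTail M s + chooseTail M (s + 1) := by
  have h : ∀ i, ((M + 1).choose (s + 1 + i) : ℤ) = M.choose (s + i) + M.choose (s + 1 + i) := by
    intro i
    rw [show s + 1 + i = s + i + 1 by lia, Nat.choose_succ_succ]
    push_cast
    ring
  unfold chooseTail
  rw [sum_congr rfl fun i _ => h i, sum_add_distrib, sum_range_succ, sum_range_succ _ (M + 1),
    choose_add_eq_zero (Nat.lt_succ_self M), choose_add_eq_zero (Nat.lt_succ_self M)]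
  simp

/-- By Pascal's rule; shifting the index in one of the two sums turns the weight `i` into `i + 1`,
and this produces the tail. -/
lemma chooseMoment_succ (M s : ℕ) : chooseMoment (M + 1) (s + 1) =
    2 * chooseMoment M (s + 1) + chooseTail M (s + 1) := by
  have h : ∀ i : ℕ, (i : ℤ) * ((M + 1).choose (s + 1 + i) : ℤ) =
      i * M.choose (s + i) + i * M.choose (s + 1 + i) := by
    intro i
    rw [show s + 1 + i = s + i + 1 by lia, Nat.choose_succ_succ]
    push_cast
    ring
  have h2 : ∑ i ∈ range (M + 1 + 1), (i : ℤ) * M.choose (s + i) =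
      chooseMoment M (s + 1) + chooseTail M (s + 1) := by
    rw [sum_range_succ', chooseMoment, chooseTail, ← sum_add_distrib]
    simp only [Nat.cast_zero, zero_mul, add_zero]
    refine sum_congr rfl fun i _ => ?_
    rw [show s + (i + 1) = s + 1 + i by lia]
    push_cast
    ring
  rw [chooseMoment, sum_congr rfl fun i _ => h i, sum_add_distrib, h2, sum_range_succ,
    choose_add_eq_zero (Nat.lt_succ_self M), ← chooseMoment]
  push_cast
  ring

/-- The symmetry of row `2m` makes the parts on either side of the middle coefficient equal. -/
lemma chooseTail_half (m : ℕ) : 2 * chooseTail (2 * m) (m + 1) + (2 * m).choose m = 4 ^ m := by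
  have h1 : chooseTail (2 * m) (m + 1) = ∑ i ∈ range m, ((2 * m).choose (m + 1 + i) : ℤ) := by
    rw [chooseTail]
    symm
    refine sum_subset (range_subset_range.mpr (by lia)) fun i _ hi => ?_
    rw [mem_range] at hi
    rw [Nat.choose_eq_zero_of_lt (by lia), Nat.cast_zero]
  have h2 : ∑ i ∈ range m, ((2 * m).choose i : ℤ) =
      ∑ i ∈ range m, ((2 * m).choose (m + 1 + i) : ℤ) := by
    rw [← sum_range_reflect]
    refine sum_congr rfl fun i hi => ?_
    rw [mem_range] at hi
    rw [← Nat.choose_symm_of_eq_add (show 2 * m = m - 1 - i + (m + 1 + i) by lia)]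
  have h3 : ∑ i ∈ range (m + 1 + m), ((2 * m).choose i : ℤ) = 4 ^ m := by
    have := Nat.sum_range_choose (2 * m)
    rw [show m + 1 + m = 2 * m + 1 by lia]
    rw [pow_mul] at this
    exact_mod_cast this
  rw [sum_range_add, sum_range_succ, h2, ← h1] at h3
  linear_combination h3

lemma chooseTail_odd (m : ℕ) : chooseTail (2 * m + 1) (m + 1) = 4 ^ m := by
  have h := chooseTail_half m
  have h1 : chooseTail (2 * m) m = (2 * m).choose m + chooseTail (2 * m) (m + 1) := by
    rw [chooseTail, sum_range_succ', chooseTail, sum_range_succ _ (2 * m), add_zero,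
      Nat.choose_eq_zero_of_lt (show 2 * m < m + 1 + 2 * m by lia)]
    rw [Nat.cast_zero, add_zero, add_comm]
    congr 1
    refine sum_congr rfl fun i _ => ?_
    rw [show m + (i + 1) = m + 1 + i by lia]
  rw [chooseTail_succ, h1]
  linear_combination h

/-- The sum of `(2 j - M) C(M, j)` over `j ≥ s` telescopes. -/
lemma two_mul_chooseMoment (M s : ℕ) :
    2 * chooseMoment M s + (2 * s - M) * chooseTail M s = s * M.choose s := by
  have h : ∀ j : ℕ, (2 * (j : ℤ) - M) * M.choose j = j * M.choose j - (j + 1) * M.choose (j + 1) := by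
    intro j
    rcases lt_or_ge M j with hj | hj
    · rw [Nat.choose_eq_zero_of_lt hj, Nat.choose_eq_zero_of_lt (by lia)]
      simp
    · have h1 := Nat.choose_succ_right_eq M j
      have h2 : (M.choose (j + 1) : ℤ) * (j + 1) = M.choose j * (M - j) := by
        rw [← Nat.cast_sub hj]
        exact_mod_cast h1
      linear_combination h2
  rw [chooseMoment, chooseTail, mul_sum, mul_sum, ← sum_add_distrib]
  have h3 : ∀ i ∈ range (M + 1), 2 * ((i : ℤ) * (M.choose (s + i) : ℤ)) +
      (2 * s - M) * (M.choose (s + i) : ℤ) =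
      (fun i : ℕ => ((s + i : ℕ) : ℤ) * (M.choose (s + i) : ℤ)) i -
      (fun i : ℕ => ((s + i : ℕ) : ℤ) * (M.choose (s + i) : ℤ)) (i + 1) := by
    intro i _
    have := h (s + i)
    simp only [← add_assoc]
    push_cast at this ⊢
    linear_combination this
  rw [sum_congr rfl h3, sum_range_sub']
  simp [choose_add_eq_zero (Nat.lt_succ_self M)]

/-! ### Solving the recursion for upper sets -/

/-- The numbers `1, 1, 2, 4, 8, …`. -/
def halfPow (k : ℕ) : ℤ := if k = 0 then 1 else 2 ^ (k - 1)

/-- The tail correction in the formula for the number of upper sets. -/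
def upperTail (n k : ℕ) : ℤ := if k = 0 then 0 else chooseTail (k - 1) n

lemma sum_halfPow (m : ℕ) : ∑ k ∈ range (m + 1), halfPow k = 2 ^ m := by
  induction m with
  | zero => simp [halfPow]
  | succ m ih =>
    rw [sum_range_succ, ih, halfPow, if_neg (Nat.succ_ne_zero m), Nat.add_sub_cancel]
    ring

lemma sum_upperTail (n M : ℕ) : ∑ k ∈ range (M + 1), upperTail n k = chooseTail M (n + 1) := by
  induction M with
  | zero => rw [chooseTail_eq_zero (by lia)]; simp [upperTail]
  | succ M ih =>
    rw [sum_range_succ, ih, upperTail, if_neg (Nat.succ_ne_zero M), Nat.add_sub_cancel,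
      chooseTail_succ, add_comm]

lemma upperTail_eq_zero {n k : ℕ} (h : k ≤ n) : upperTail n k = 0 := by
  rw [upperTail]
  split_ifs
  · rfl
  · exact chooseTail_eq_zero (by lia)

/-- `halfPow` solves the recursion without the cutoff on `k`, and `upperTail` corrects for the
cutoff. The formula is kept up to `k = 2n`, one beyond the possible row sizes, because the next
instance of the recursion sums over `j ≤ 2n`. -/
lemma upperCount_eq (n k : ℕ) (hk : k ≤ 2 * n) :
    (upperCount n k : ℤ) = halfPow k - 2 * upperTail n k := by
  induction n generalizing k with
  | zero =>
    obtain rfl : k = 0 := by lia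
    simp [upperCount, halfPow, upperTail]
  | succ n ih =>
    rcases k with _ | k
    · simp [upperCount, halfPow, upperTail, ih]
    rw [upperCount, halfPow, upperTail, if_neg (Nat.succ_ne_zero k), if_neg (Nat.succ_ne_zero k),
      Nat.add_sub_cancel]
    split_ifs with hk'
    · rw [Nat.max_eq_left (by lia), Nat.cast_sum, sum_congr rfl fun j hj => ih j (by
        rw [mem_range] at hj; lia), sum_sub_distrib, ← mul_sum, sum_halfPow, sum_upperTail]
    -- Here the count is 0 by the cutoff, and the formula vanishes as well since the tail is exactly
    -- half of the row sum.
    · obtain rfl : k = 2 * n + 1 := by lia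
      rw [chooseTail_odd, pow_succ, pow_mul]
      push_cast
      ring

/-! ### Evaluating the double sum -/

lemma sum_triangle_comm (M : ℕ) (f : ℕ → ℕ → ℤ) :
    ∑ k ∈ range (M + 1), ∑ l ∈ range (M + 1 - k), f k l =
      ∑ k ∈ range (M + 1), ∑ l ∈ range (M + 1 - k), f l k := by
  refine sum_comm' fun k l => ?_
  simp only [mem_range]
  lia

lemma sum_triangle_halfPow (M : ℕ) (f : ℕ → ℤ) :
    ∑ k ∈ range (M + 1), ∑ l ∈ range (M + 1 - k), f k * halfPow l =
      ∑ k ∈ range (M + 1), f k * 2 ^ (M - k) := by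
  refine sum_congr rfl fun k hk => ?_
  rw [mem_range] at hk
  rw [← mul_sum, show M + 1 - k = M - k + 1 by lia, sum_halfPow]

lemma sum_halfPow_mul_pow (M : ℕ) :
    2 * ∑ k ∈ range (M + 1), halfPow k * 2 ^ (M - k) = (M + 2) * 2 ^ M := by
  rw [sum_range_succ']
  have h : ∀ k ∈ range M, halfPow (k + 1) * 2 ^ (M - (k + 1)) = 2 ^ (M - 1) := by
    intro k hk
    rw [mem_range] at hk
    rw [halfPow, if_neg (Nat.succ_ne_zero k), Nat.add_sub_cancel, ← pow_add]
    congr 1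
    lia
  rw [sum_congr rfl h, sum_const, card_range, halfPow, if_pos rfl]
  rcases M with _ | M
  · simp
  · simp only [Nat.add_sub_cancel, nsmul_eq_mul, Nat.sub_zero, pow_succ]
    push_cast
    ring

/-- Both sides satisfy the recursion of `chooseMoment_succ` in `M`. -/
lemma sum_upperTail_mul_pow (n M : ℕ) :
    ∑ k ∈ range (M + 1), upperTail (n + 1) k * 2 ^ (M - k) = chooseMoment M (n + 1) := by
  induction M with
  | zero => simp [upperTail, chooseMoment]
  | succ M ih =>
    rw [sum_range_succ, chooseMoment_succ, ← ih, mul_sum, upperTail, if_neg (Nat.succ_ne_zero M),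
      Nat.add_sub_cancel, Nat.sub_self, pow_zero, mul_one]
    congr 1
    refine sum_congr rfl fun k hk => ?_
    rw [mem_range] at hk
    rw [show M + 1 - k = M - k + 1 by lia, pow_succ]
    ring

lemma sum_triangle_upperCount {n M : ℕ} (hM : M ≤ 2 * n + 1) :
    2 * ∑ k ∈ range (M + 1), ∑ l ∈ range (M + 1 - k),
      (upperCount (n + 1) k : ℤ) * upperCount (n + 1) l =
      (M + 2) * 2 ^ M - 8 * chooseMoment M (n + 1) := by
  have h : ∀ k ∈ range (M + 1), ∀ l ∈ range (M + 1 - k),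
      (upperCount (n + 1) k : ℤ) * upperCount (n + 1) l = halfPow k * halfPow l -
        2 * (upperTail (n + 1) k * halfPow l) - 2 * (upperTail (n + 1) l * halfPow k) := by
    intro k hk l hl
    rw [mem_range] at hk hl
    -- Since `k + l ≤ 2n + 1`, the smaller index is at most `n`, where the correction vanishes. The
    -- product is thus linear in the corrections.
    have h0 : upperTail (n + 1) k * upperTail (n + 1) l = 0 := by
      rcases le_total k l with hkl | hkl
      · rw [upperTail_eq_zero (k := k) (by lia), zero_mul]
      · rw [upperTail_eq_zero (k := l) (by lia), mul_zero]
    rw [upperCount_eq _ _ (by lia), upperCount_eq _ _ (by lia)]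
    linear_combination 4 * h0
  rw [sum_congr rfl fun k hk => sum_congr rfl (h k hk)]
  simp only [sum_sub_distrib, ← mul_sum]
  rw [sum_triangle_comm M fun k l => upperTail (n + 1) l * halfPow k]
  simp only [mul_sum _ _ (upperTail _ _), mul_sum _ _ (halfPow _)]
  rw [sum_triangle_halfPow, sum_triangle_halfPow, sum_upperTail_mul_pow]
  linear_combination sum_halfPow_mul_pow M

/-- When `k + l ≤ N + 1` the minima are `k` and `l`. Otherwise they are `N + 1 - l` and `N + 1 - k`,
and these two numbers run over the pairs with sum at most `N`. -/
lemma sum_square_eq_triangles (N : ℕ) (F : ℕ → ℤ) :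
    ∑ x ∈ range (N + 2) ×ˢ range (N + 2), F (min x.1 (N + 1 - x.2)) * F (min x.2 (N + 1 - x.1)) =
      ∑ k ∈ range (N + 2), ∑ l ∈ range (N + 2 - k), F k * F l +
      ∑ k ∈ range (N + 1), ∑ l ∈ range (N + 1 - k), F k * F l := by
  rw [sum_product]
  have h : ∀ k ∈ range (N + 2), ∑ l ∈ range (N + 2), F (min k (N + 1 - l)) * F (min l (N + 1 - k)) =
      ∑ l ∈ range (N + 2 - k), F k * F l + ∑ l ∈ range k, F (N + 1 - k) * F l := by
    intro k hk
    rw [mem_range] at hk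
    nth_rewrite 1 [show N + 2 = N + 2 - k + k by lia]
    rw [sum_range_add]
    congr 1
    · refine sum_congr rfl fun l hl => ?_
      rw [mem_range] at hl
      rw [min_eq_left (by lia), min_eq_left (by lia)]
    · rw [← sum_range_reflect]
      refine sum_congr rfl fun l hl => ?_
      rw [mem_range] at hl
      rw [min_eq_right (by lia), min_eq_right (by lia), mul_comm]
      congr 2
      lia
  rw [sum_congr rfl h, sum_add_distrib]
  congr 1
  rw [← sum_range_reflect, sum_range_succ]
  rw [show N + 2 - 1 - (N + 1) = 0 by lia, range_zero, sum_empty, add_zero]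
  refine sum_congr rfl fun k hk => ?_
  rw [mem_range] at hk
  rw [show N + 2 - 1 - k = N + 1 - k by lia, show N + 1 - (N + 1 - k) = k by lia]

lemma sum_upperCount (n : ℕ) :
    ∑ x ∈ range (2 * n + 2) ×ˢ range (2 * n + 2),
      (upperCount (n + 1) (min x.1 (2 * n + 1 - x.2)) : ℤ) *
        upperCount (n + 1) (min x.2 (2 * n + 1 - x.1)) =
      (3 * n + 8) * 4 ^ n - 2 * (3 * n + 2) * (2 * n).choose n := by
  rw [sum_square_eq_triangles (2 * n) fun k => (upperCount (n + 1) k : ℤ)]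
  have h1 := sum_triangle_upperCount (n := n) (M := 2 * n + 1) le_rfl
  have h2 := sum_triangle_upperCount (n := n) (M := 2 * n) (by lia)
  have h3 := chooseMoment_succ (2 * n) n
  have h4 := two_mul_chooseMoment (2 * n) (n + 1)
  have h5 := chooseTail_half n
  have h6 : ((n : ℤ) + 1) * (2 * n).choose (n + 1) = n * (2 * n).choose n := by
    have h := Nat.choose_succ_right_eq (2 * n) n
    rw [show 2 * n - n = n by lia] at h
    have h' : ((2 * n).choose (n + 1) : ℤ) * (n + 1) = (2 * n).choose n * n := by exact_mod_cast h
    linear_combination h'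
  have h7 : (2 : ℤ) ^ (2 * n) = 4 ^ n := by rw [pow_mul]; norm_num
  rw [pow_succ, h7] at h1
  rw [h7] at h2
  push_cast at h1 h2 h4
  refine mul_left_cancel₀ (two_ne_zero (α := ℤ)) ?_
  rw [mul_add, h1, h2, h3]
  -- By `h3` the two triangles contribute `-24` moments and `-8` tails. `h4` and `h6` trade the
  -- moments for tails and the central coefficient, and `h5` evaluates the tails.
  linear_combination (-12) * h4 + 8 * h5 - 12 * h6

end TypeB
end

theorem theorem1 (n : ℕ) (hn : 2 ≤ n) :
    {I : LieIdeal ℂ (TypeB.affineBorel n) | TypeB.IsBasicIdeal I}.Finite ∧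
    ({I : LieIdeal ℂ (TypeB.affineBorel n) | TypeB.IsBasicIdeal I}.ncard : ℤ) =
      (3 * (n : ℤ) + 5) * 2 ^ (2 * n - 2)
        - 2 * (3 * (n : ℤ) - 1) * ((2 * n - 2).choose (n - 1) : ℤ) := by
  obtain ⟨m, rfl⟩ : ∃ m, n = m + 1 := ⟨n - 1, by lia⟩
  have h := (TypeB.encard_eq_of_bijOn (TypeB.bijOn_basicIdeals (Nat.succ_pos m))).trans
    (TypeB.encard_commutingPairs m)
  refine ⟨Set.finite_of_encard_eq_coe h, ?_⟩
  rw [Set.ncard, h, ENat.toNat_natCast]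
  have hs := TypeB.sum_upperCount m
  push_cast
  rw [hs, show 2 * (m + 1) - 2 = 2 * m by lia, pow_mul]
  ring
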